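/- Let $q>0$ be real, $q\neq 1$, and $[x]=\frac{q^{x/2}-q^{-x/2}}{q^{1/2}-q^{-1/2}}$. Let $\mathcal F$ be the Fock space of two commuting $q$-bosons: the finite linear combinations of orthonormal states $|n_a,n_b\rangle$, $n_a,n_b\in\mathbb N$, with $a|n_a,n_b\rangle=\sqrt{[n_a]}\,|n_a-1,n_b\rangle$, $a^\dagger|n_a,n_b\rangle=\sqrt{[n_a+1]}\,|n_a+1,n_b\rangle$, the analogous $b,b^\dagger$ acting on $n_b$, and number operators $N_a,N_b$. Let $\mathcal U_q(\mathfrak{su}(2))$ be generated by $J_\pm$ and $K^{\pm1}=q^{\pm J_z/2}$ with $KJ_\pm K^{-1}=q^{\pm1/2}J_\pm$, $[J_+,J_-]=[2J_z]=\frac{K^2-K^{-2}}{q^{1/2}-q^{-1/2}}$ and antipode $S(J_\pm)=-q^{\pm1/2}J_\pm$, $S(K)=K^{-1}$. It acts on $\mathcal F$ by the Jordan map $J_+=a^\dagger b$, $J_-=ab^\dagger$, $K=q^{(N_a-N_b)/4}$. Define the quantum flux $$\tilde L=\begin{pmatrix}K&0\\ q^{-1/4}(q^{1/2}-q^{-1/2})J_+&K^{-1}\end{pmatrix},$$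 let $S(\tilde L)$ be obtained by applying $S$ to every entry, and for a matrix $M$ of operators let $(M^\dagger)_A{}^B=(M_B{}^A)^\dagger$, where $\dagger$ on the right is the adjoint on $\mathcal F$. Define the spinors (components $A=-,+$; sign $\epsilon=\pm$) $$\tilde{\boldsymbol\tau}^-=\begin{pmatrix}q^{-N_b/4}a\\ q^{N_a/4}b\end{pmatrix},\quad \tilde{\boldsymbol\tau}^+=\begin{pmatrix}-b^\dagger q^{(N_a+1)/4}\\ a^\dagger q^{-(N_b+1)/4}\end{pmatrix},\quad \tilde{\mathbf t}^-=\begin{pmatrix}q^{N_b/4}a\\ q^{-N_a/4}b\end{pmatrix},\quad \tilde{\mathbf t}^+=\begin{pmatrix}-b^\dagger q^{-(N_a+1)/4}\\ a^\dagger q^{(N_b+1)/4}\end{pmatrix}.$$ On $\mathcal F^{\otimes N}$ (one factor per ribbon at the vertex), for an operator $X$ on $\mathcal F$ let $X_n$ be $X$ acting on the $n$-th factor, and for $i\ne j$ let $\mathcal R_{ij}$ be the universal $R$-matrix $$\mathcal R=q^{J_z\otimes J_z}\sum_{m\ge0}\frac{(1-q^{-1})^m}{[m]!}\,q^{m(m-1)/4}\,(KJ_+)^m\otimes(K^{-1}J_-)^m$$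 with its first tensor factor on the $i$-th and its second on the $j$-th ribbon (on each vector the sum is finite). **Proposition (the braiding induced by the $R$-matrix is a parallel transport).** For all $N$ and $i\neq j$ the operator $\mathcal R_{ij}$ is invertible, and for all $1\le n\le N$, $\epsilon=\pm$ and $A=\pm$ (the index $\epsilon$ being omitted), $$\mathcal R_{n-1,n}^{-1}\cdots\mathcal R_{1n}^{-1}\,(\tilde{\boldsymbol\tau}_A)_n\,\mathcal R_{1n}\cdots\mathcal R_{n-1,n}=\big(\tilde L\otimes\cdots\otimes\tilde L\otimes\tilde{\boldsymbol\tau}\big)_A\otimes\mathrm{id}\otimes\cdots,$$ $$\mathcal R_{n,n-1}\cdots\mathcal R_{n1}\,(\tilde{\boldsymbol\tau}_A)_n\,\mathcal R_{n1}^{-1}\cdots\mathcal R_{n,n-1}^{-1}=\big(S(\tilde L)^\dagger\otimes\cdots\otimes S(\tilde L)^\dagger\otimes\tilde{\boldsymbol\tau}\big)_A\otimes\mathrm{id}\otimes\cdots,$$ $$\mathcal R_{n-1,n}\cdots\mathcal R_{1n}\,(\tilde{\mathbf t}_A)_n\,\mathcal R_{1n}^{-1}\cdots\mathcal R_{n-1,n}^{-1}=\big(S(\tilde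 L)\otimes\cdots\otimes S(\tilde L)\otimes\tilde{\mathbf t}\big)_A\otimes\mathrm{id}\otimes\cdots,$$ $$\mathcal R_{n,n-1}^{-1}\cdots\mathcal R_{n1}^{-1}\,(\tilde{\mathbf t}_A)_n\,\mathcal R_{n1}\cdots\mathcal R_{n,n-1}=\big(\tilde L^\dagger\otimes\cdots\otimes\tilde L^\dagger\otimes\tilde{\mathbf t}\big)_A\otimes\mathrm{id}\otimes\cdots.$$ Here, for a matrix $M$ of operators and a spinor $s$, $(M\otimes\cdots\otimes M\otimes s)_A\otimes\mathrm{id}\otimes\cdots$ is the component $A$ of the parallel transported spinor $M_{1}M_{2}\cdots M_{n-1}s_n$ (the $2\times2$ matrix product, the entries of $M_k$ acting on the $k$-th ribbon), which in components is $$\sum_{A_2,\dots,A_n=\pm}M_{A}{}^{A_2}\otimes M_{A_2}{}^{A_3}\otimes\cdots\otimes M_{A_{n-1}}{}^{A_n}\otimes s_{A_n}\otimes\mathrm{id}\otimes\cdots\otimes\mathrm{id}.$$ -/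

import Mathlib

open scoped TensorProduct

noncomputable section

namespace QRibbon

/-! ### The deformation parameter -/

/-- The deformation parameter: a real number `q > 0` with `q ≠ 1`. -/
abbrev DeformParam : Type := {q : ℝ // 0 < q ∧ q ≠ 1}

/-- The real power `q ^ x`, seen as a complex number. -/
def qpow (q : DeformParam) (x : ℝ) : ℂ := ((q.1 ^ x : ℝ) : ℂ)

/-- The `q`-number `[n] = (q^{n/2} - q^{-n/2}) / (q^{1/2} - q^{-1/2})`. -/
def qnum (q : DeformParam) (n : ℝ) : ℝ :=
  (q.1 ^ (n / 2) - q.1 ^ (-(n / 2))) / (q.1 ^ (1 / 2 : ℝ) - q.1 ^ (-(1 / 2) : ℝ))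

/-- The `q`-factorial `[n]! = [1] [2] ⋯ [n]`. -/
def qfactorial (q : DeformParam) (n : ℕ) : ℝ := ∏ k ∈ Finset.range n, qnum q ((k : ℝ) + 1)

theorem qpow_add (q : DeformParam) (x y : ℝ) : qpow q (x + y) = qpow q x * qpow q y := by
  simp only [qpow, Real.rpow_add q.2.1, Complex.ofReal_mul]

theorem qpow_zero (q : DeformParam) : qpow q 0 = 1 := by simp [qpow]

/-! ### The quantum group `U_q(su(2))` and its antipode -/

/-- The generators `J_+`, `J_-`, `K` and `K⁻¹`. -/
inductive Gen : Type
  | Jp | Jm | K | Kinv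

/-- The defining relations of `U_q(su(2))`, where `K = q^{J_z/2}`:
`K K⁻¹ = K⁻¹ K = 1`, `K J_± K⁻¹ = q^{±1/2} J_±` and
`[J_+, J_-] = [2 J_z] = (K² - K⁻²) / (q^{1/2} - q^{-1/2})`. -/
inductive Rel (q : DeformParam) : FreeAlgebra ℂ Gen → FreeAlgebra ℂ Gen → Prop
  | K_Kinv : Rel q (FreeAlgebra.ι ℂ Gen.K * FreeAlgebra.ι ℂ Gen.Kinv) 1
  | Kinv_K : Rel q (FreeAlgebra.ι ℂ Gen.Kinv * FreeAlgebra.ι ℂ Gen.K) 1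
  | K_Jp : Rel q (FreeAlgebra.ι ℂ Gen.K * FreeAlgebra.ι ℂ Gen.Jp * FreeAlgebra.ι ℂ Gen.Kinv)
      (qpow q (1 / 2) • FreeAlgebra.ι ℂ Gen.Jp)
  | K_Jm : Rel q (FreeAlgebra.ι ℂ Gen.K * FreeAlgebra.ι ℂ Gen.Jm * FreeAlgebra.ι ℂ Gen.Kinv)
      (qpow q (-(1 / 2)) • FreeAlgebra.ι ℂ Gen.Jm)
  | Jp_Jm : Rel q
      (FreeAlgebra.ι ℂ Gen.Jp * FreeAlgebra.ι ℂ Gen.Jm -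
        FreeAlgebra.ι ℂ Gen.Jm * FreeAlgebra.ι ℂ Gen.Jp)
      ((qpow q (1 / 2) - qpow q (-(1 / 2)))⁻¹ •
        (FreeAlgebra.ι ℂ Gen.K ^ 2 - FreeAlgebra.ι ℂ Gen.Kinv ^ 2))

/-- The algebra `U_q(su(2))`. -/
abbrev Uq (q : DeformParam) : Type := RingQuot (Rel q)

/-- The generators as elements of `U_q(su(2))`. -/
def gen (q : DeformParam) (g : Gen) : Uq q := RingQuot.mkAlgHom ℂ (Rel q) (FreeAlgebra.ι ℂ g)

/-- Values of the antipode on the generators: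
`S(J_±) = -q^{±1/2} J_±`, `S(K) = K⁻¹`, `S(K⁻¹) = K`. -/
def antipodeGen (q : DeformParam) : Gen → (Uq q)ᵐᵒᵖ
  | .Jp => MulOpposite.op ((-qpow q (1 / 2)) • gen q .Jp)
  | .Jm => MulOpposite.op ((-qpow q (-(1 / 2))) • gen q .Jm)
  | .K => MulOpposite.op (gen q .Kinv)
  | .Kinv => MulOpposite.op (gen q .K)

theorem gen_K_Kinv (q : DeformParam) : gen q .K * gen q .Kinv = 1 := by
  simpa [gen] using RingQuot.mkAlgHom_rel ℂ (Rel.K_Kinv (q := q))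

theorem gen_Kinv_K (q : DeformParam) : gen q .Kinv * gen q .K = 1 := by
  simpa [gen] using RingQuot.mkAlgHom_rel ℂ (Rel.Kinv_K (q := q))

theorem gen_K_Jp (q : DeformParam) :
    gen q .K * gen q .Jp * gen q .Kinv = qpow q (1 / 2) • gen q .Jp := by
  simpa [gen] using RingQuot.mkAlgHom_rel ℂ (Rel.K_Jp (q := q))

theorem gen_K_Jm (q : DeformParam) :
    gen q .K * gen q .Jm * gen q .Kinv = qpow q (-(1 / 2)) • gen q .Jm := by
  simpa [gen] using RingQuot.mkAlgHom_rel ℂ (Rel.K_Jm (q := q))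

theorem gen_Jp_Jm (q : DeformParam) :
    gen q .Jp * gen q .Jm - gen q .Jm * gen q .Jp =
      (qpow q (1 / 2) - qpow q (-(1 / 2)))⁻¹ • (gen q .K ^ 2 - gen q .Kinv ^ 2) := by
  simpa [gen] using RingQuot.mkAlgHom_rel ℂ (Rel.Jp_Jm (q := q))

theorem qpow_half_mul (q : DeformParam) : qpow q (1 / 2) * qpow q (-(1 / 2)) = 1 := by
  rw [← qpow_add, add_neg_cancel, qpow_zero]

theorem antipode_rel (q : DeformParam) {x y : FreeAlgebra ℂ Gen} (h : Rel q x y) :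
    FreeAlgebra.lift ℂ (antipodeGen q) x = FreeAlgebra.lift ℂ (antipodeGen q) y := by
  apply MulOpposite.unop_injective
  cases h with
  | K_Kinv => simpa [antipodeGen] using gen_K_Kinv q
  | Kinv_K => simpa [antipodeGen] using gen_Kinv_K q
  | K_Jp =>
    simpa only [antipodeGen, map_mul, map_smul, FreeAlgebra.lift_ι_apply, MulOpposite.unop_mul,
      MulOpposite.unop_smul, MulOpposite.unop_op, mul_smul_comm, smul_mul_assoc, mul_assoc,
      smul_smul, mul_comm] using congrArg ((-qpow q (1 / 2)) • ·) (gen_K_Jp q)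
  | K_Jm =>
    simpa only [antipodeGen, map_mul, map_smul, FreeAlgebra.lift_ι_apply, MulOpposite.unop_mul,
      MulOpposite.unop_smul, MulOpposite.unop_op, mul_smul_comm, smul_mul_assoc, mul_assoc,
      smul_smul, mul_comm] using congrArg ((-qpow q (-(1 / 2))) • ·) (gen_K_Jm q)
  | Jp_Jm =>
    have h1 := qpow_half_mul q
    have h2 : qpow q (-(1 / 2)) * qpow q (1 / 2) = 1 := by rw [mul_comm]; exact h1
    have h3 := gen_Jp_Jm q
    have h4 : gen q .Jm * gen q .Jp - gen q .Jp * gen q .Jm =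
        (qpow q (1 / 2) - qpow q (-(1 / 2)))⁻¹ • (gen q .Kinv ^ 2 - gen q .K ^ 2) := by
      rw [← neg_sub, h3, ← neg_sub (gen q .K ^ 2)]
      exact (smul_neg (M := ℂ) (A := Uq q) _ _).symm
    simpa only [antipodeGen, map_mul, map_smul, map_sub, map_pow, FreeAlgebra.lift_ι_apply,
      MulOpposite.unop_mul, MulOpposite.unop_smul, MulOpposite.unop_op, MulOpposite.unop_sub,
      MulOpposite.unop_pow, mul_smul_comm, smul_mul_assoc, smul_smul, neg_mul_neg, h1, h2,
      one_smul] using h4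

/-- The antipode `S` of `U_q(su(2))`: the antihomomorphism (a homomorphism into the opposite
algebra) with the values `antipodeGen` on the generators. -/
def antipodeOp (q : DeformParam) : Uq q →ₐ[ℂ] (Uq q)ᵐᵒᵖ :=
  RingQuot.liftAlgHom ℂ ⟨FreeAlgebra.lift ℂ (antipodeGen q), fun _ _ h => antipode_rel q h⟩

/-- The antipode `S : U_q(su(2)) → U_q(su(2))`. -/
def antipode (q : DeformParam) (x : Uq q) : Uq q := MulOpposite.unop (antipodeOp q x)

/-! ### The `q`-boson Fock space of one ribbon and the Jordan map -/

/-- The Fock space of the two tilde `q`-bosons `ã`, `b̃` of one ribbon: finite linear combinations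
of the occupation number states `|n_a, n_b⟩`.  It is the algebraic direct sum of the irreducible
representations `V^j`, `j = 0, 1/2, 1, …`, with `j = (n_a + n_b)/2` and `m = (n_a - n_b)/2`. -/
abbrev Fock : Type := (ℕ × ℕ) →₀ ℂ

/-- The occupation number state `|n_a, n_b⟩`. -/
abbrev ket (s : ℕ × ℕ) : Fock := Finsupp.single s 1

/-- Operators on the Fock space of one ribbon. -/
abbrev FockOp : Type := Module.End ℂ Fock

/-- The operator with prescribed values on the occupation number states. -/
def opOfKet (f : ℕ × ℕ → Fock) : FockOp := Finsupp.linearCombination ℂ f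

@[simp] theorem opOfKet_ket (f : ℕ × ℕ → Fock) (s : ℕ × ℕ) : opOfKet f (ket s) = f s := by
  simp [opOfKet]

/-- `a |n_a, n_b⟩ = √[n_a] |n_a - 1, n_b⟩`; this is `0` if `n_a = 0`. -/
def aOp (q : DeformParam) : FockOp :=
  opOfKet fun s => ((√(qnum q s.1) : ℝ) : ℂ) • ket (s.1 - 1, s.2)

/-- `b |n_a, n_b⟩ = √[n_b] |n_a, n_b - 1⟩`; this is `0` if `n_b = 0`. -/
def bOp (q : DeformParam) : FockOp :=
  opOfKet fun s => ((√(qnum q s.2) : ℝ) : ℂ) • ket (s.1, s.2 - 1)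

/-- `a† |n_a, n_b⟩ = √[n_a + 1] |n_a + 1, n_b⟩`. -/
def aDag (q : DeformParam) : FockOp :=
  opOfKet fun s => ((√(qnum q ((s.1 : ℝ) + 1)) : ℝ) : ℂ) • ket (s.1 + 1, s.2)

/-- `b† |n_a, n_b⟩ = √[n_b + 1] |n_a, n_b + 1⟩`. -/
def bDag (q : DeformParam) : FockOp :=
  opOfKet fun s => ((√(qnum q ((s.2 : ℝ) + 1)) : ℝ) : ℂ) • ket (s.1, s.2 + 1)

/-- `q^{f(N_a, N_b)}` for a real function `f` of the number operators `N_a`, `N_b`. -/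
def qpowN (q : DeformParam) (f : ℝ → ℝ → ℝ) : FockOp :=
  opOfKet fun s => qpow q (f s.1 s.2) • ket s

/-- The Jordan map on generators:
`J_+ = a† b`, `J_- = a b†`, `K^{±1} = q^{±(N_a - N_b)/4}`. -/
def jordanGen (q : DeformParam) : Gen → FockOp
  | .Jp => aDag q * bOp q
  | .Jm => aOp q * bDag q
  | .K => qpowN q fun x y => (x - y) / 4
  | .Kinv => qpowN q fun x y => -((x - y) / 4)

theorem op_ext {A B : FockOp} (h : ∀ s, A (ket s) = B (ket s)) : A = B :=
  Finsupp.lhom_ext' fun s => LinearMap.ext_ring (h s)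

@[simp] theorem qnum_zero (q : DeformParam) : qnum q 0 = 0 := by simp [qnum]

theorem qnum_den_sq_pos (q : DeformParam) :
    q.1 ^ (1 / 2 : ℝ) - q.1 ^ (-(1 / 2) : ℝ) ≠ 0 := by
  intro h
  have h1 : (1 / 2 : ℝ) = -(1 / 2) :=
    (Real.rpow_right_inj q.2.1 q.2.2).1 (sub_eq_zero.1 h)
  norm_num at h1

theorem qnum_nonneg (q : DeformParam) {x : ℝ} (hx : 0 ≤ x) : 0 ≤ qnum q x := by
  obtain ⟨q, h0, h1⟩ := q
  rcases lt_or_gt_of_ne h1 with h | h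
  · apply div_nonneg_of_nonpos <;> rw [sub_nonpos] <;>
      exact Real.rpow_le_rpow_of_exponent_ge h0 h.le (by linarith)
  · apply div_nonneg <;> rw [sub_nonneg] <;>
      exact Real.rpow_le_rpow_of_exponent_le h.le (by linarith)

theorem qnum_identity (q : DeformParam) (x y : ℝ) :
    qnum q x * qnum q (y + 1) - qnum q (x + 1) * qnum q y =
      (q.1 ^ ((x - y) / 2) - q.1 ^ (-((x - y) / 2))) /
        (q.1 ^ (1 / 2 : ℝ) - q.1 ^ (-(1 / 2) : ℝ)) := by
  have hd := qnum_den_sq_pos q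
  have h0 := q.2.1
  have e1 : ∀ u v : ℝ, q.1 ^ u * q.1 ^ v = q.1 ^ (u + v) := fun u v => (Real.rpow_add h0 u v).symm
  simp only [qnum]
  rw [div_mul_div_comm, div_mul_div_comm, ← sub_div, div_eq_div_iff (mul_ne_zero hd hd) hd]
  rw [← mul_assoc]
  congr 1
  simp only [sub_mul, mul_sub, e1]
  ring_nf

theorem jordan_Jp_zero (q : DeformParam) (m : ℕ) : jordanGen q .Jp (ket (m, 0)) = 0 := by
  simp [jordanGen, bOp]

theorem jordan_Jp_succ (q : DeformParam) (m n : ℕ) : jordanGen q .Jp (ket (m, n + 1)) =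
    (((√(qnum q ((m : ℝ) + 1)) : ℝ) : ℂ) * ((√(qnum q ((n : ℝ) + 1)) : ℝ) : ℂ)) •
      ket (m + 1, n) := by
  simp only [jordanGen, Module.End.mul_apply, bOp, aDag, opOfKet_ket, map_smul, smul_smul,
    Nat.add_sub_cancel, Nat.cast_add, Nat.cast_one]
  rw [mul_comm]

theorem jordan_Jm_zero (q : DeformParam) (n : ℕ) : jordanGen q .Jm (ket (0, n)) = 0 := by
  simp only [jordanGen, Module.End.mul_apply, bDag, aOp, opOfKet_ket, map_smul]
  simp

theorem jordan_Jm_succ (q : DeformParam) (m n : ℕ) : jordanGen q .Jm (ket (m + 1, n)) =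
    (((√(qnum q ((m : ℝ) + 1)) : ℝ) : ℂ) * ((√(qnum q ((n : ℝ) + 1)) : ℝ) : ℂ)) •
      ket (m, n + 1) := by
  simp only [jordanGen, Module.End.mul_apply, bDag, aOp, opOfKet_ket, map_smul, smul_smul,
    Nat.add_sub_cancel, Nat.cast_add, Nat.cast_one]
  rw [mul_comm]

theorem jordan_K (q : DeformParam) (s : ℕ × ℕ) :
    jordanGen q .K (ket s) = qpow q (((s.1 : ℝ) - s.2) / 4) • ket s := by
  simp [jordanGen, qpowN]

theorem jordan_Kinv (q : DeformParam) (s : ℕ × ℕ) :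
    jordanGen q .Kinv (ket s) = qpow q (-(((s.1 : ℝ) - s.2) / 4)) • ket s := by
  simp [jordanGen, qpowN]

theorem sqrt_qnum_sq (q : DeformParam) (n : ℕ) :
    ((√(qnum q ((n : ℝ) + 1)) : ℝ) : ℂ) * ((√(qnum q ((n : ℝ) + 1)) : ℝ) : ℂ) =
      ((qnum q ((n : ℝ) + 1) : ℝ) : ℂ) := by
  rw [← Complex.ofReal_mul, Real.mul_self_sqrt (qnum_nonneg q (by positivity))]

theorem jordan_Jp_Jm_ket (q : DeformParam) (m n : ℕ) :
    jordanGen q .Jp (jordanGen q .Jm (ket (m, n))) =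
      ((qnum q m * qnum q ((n : ℝ) + 1) : ℝ) : ℂ) • ket (m, n) := by
  rcases m with _ | m
  · simp [jordan_Jm_zero]
  · rw [jordan_Jm_succ, map_smul, jordan_Jp_succ, smul_smul, Complex.ofReal_mul, Nat.cast_add,
      Nat.cast_one, ← sqrt_qnum_sq, ← sqrt_qnum_sq]
    congr 1
    ring

theorem jordan_Jm_Jp_ket (q : DeformParam) (m n : ℕ) :
    jordanGen q .Jm (jordanGen q .Jp (ket (m, n))) =
      ((qnum q ((m : ℝ) + 1) * qnum q n : ℝ) : ℂ) • ket (m, n) := by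
  rcases n with _ | n
  · simp [jordan_Jp_zero]
  · rw [jordan_Jp_succ, map_smul, jordan_Jm_succ, smul_smul, Complex.ofReal_mul, Nat.cast_add,
      Nat.cast_one, ← sqrt_qnum_sq, ← sqrt_qnum_sq]
    congr 1
    ring

theorem jordan_rel (q : DeformParam) {x y : FreeAlgebra ℂ Gen} (h : Rel q x y) :
    FreeAlgebra.lift ℂ (jordanGen q) x = FreeAlgebra.lift ℂ (jordanGen q) y := by
  apply op_ext
  rintro ⟨m, n⟩
  cases h with
  | K_Kinv =>
    simp only [map_mul, FreeAlgebra.lift_ι_apply, Module.End.mul_apply, jordan_K, jordan_Kinv,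
      map_smul, smul_smul, ← qpow_add, map_one, Module.End.one_apply]
    simp [qpow_zero]
  | Kinv_K =>
    simp only [map_mul, FreeAlgebra.lift_ι_apply, Module.End.mul_apply, jordan_K, jordan_Kinv,
      map_smul, smul_smul, ← qpow_add, map_one, Module.End.one_apply]
    simp [qpow_zero]
  | K_Jp =>
    simp only [map_mul, map_smul, FreeAlgebra.lift_ι_apply, Module.End.mul_apply,
      jordan_Kinv, LinearMap.smul_apply]
    rcases n with _ | n
    · simp only [jordan_Jp_zero, map_zero, smul_zero]
    · simp only [jordan_Jp_succ, map_smul, jordan_K, smul_smul]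
      rw [mul_comm, mul_assoc, ← qpow_add, mul_comm]
      push_cast
      congr 3
      ring
  | K_Jm =>
    simp only [map_mul, map_smul, FreeAlgebra.lift_ι_apply, Module.End.mul_apply,
      jordan_Kinv, LinearMap.smul_apply]
    rcases m with _ | m
    · simp only [jordan_Jm_zero, map_zero, smul_zero]
    · simp only [jordan_Jm_succ, map_smul, jordan_K, smul_smul]
      rw [mul_comm, mul_assoc, ← qpow_add, mul_comm]
      push_cast
      congr 3
      ring
  | Jp_Jm =>
    simp only [map_mul, map_smul, map_sub, FreeAlgebra.lift_ι_apply, Module.End.mul_apply,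
      LinearMap.smul_apply, LinearMap.sub_apply, jordan_Jp_Jm_ket, jordan_Jm_Jp_ket, pow_two,
      jordan_K, jordan_Kinv, smul_smul, ← qpow_add, ← sub_smul]
    rw [← Complex.ofReal_sub, qnum_identity]
    congr 1
    simp only [qpow]
    push_cast
    rw [div_eq_inv_mul]
    congr 3 <;> congr 1 <;> ring_nf

/-- The representation of `U_q(su(2))` on the Fock space of one ribbon by the Jordan map. -/
def jordan (q : DeformParam) : Uq q →ₐ[ℂ] FockOp :=
  RingQuot.liftAlgHom ℂ ⟨FreeAlgebra.lift ℂ (jordanGen q), fun _ _ h => jordan_rel q h⟩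

@[simp] theorem jordan_gen (q : DeformParam) (g : Gen) :
    jordan q (gen q g) = jordanGen q g := by
  simp [jordan, gen, RingQuot.liftAlgHom_mkAlgHom_apply]

@[simp] theorem antipode_gen (q : DeformParam) (g : Gen) :
    antipode q (gen q g) = MulOpposite.unop (antipodeGen q g) := by
  simp [antipode, antipodeOp, gen, RingQuot.liftAlgHom_mkAlgHom_apply]

/-! ### Adjoints of operators on the Fock space -/

/-- The scalar product of the Fock space, antilinear in the first argument, for which the
occupation number states are orthonormal. -/
def fockInner (x y : Fock) : ℂ := x.sum fun s c => (starRingEnd ℂ) c * y s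

/-- `B` is an adjoint of `A`. -/
def IsAdjoint (A B : FockOp) : Prop := ∀ x y : Fock, fockInner (B x) y = fockInner x (A y)

open Classical in
/-- The adjoint `A†` of an operator on the Fock space (if `A` has none, the value is `0`;
the adjoint is unique, see `dagger_eq`). -/
def dagger (A : FockOp) : FockOp := if h : ∃ B, IsAdjoint A B then h.choose else 0

theorem fockInner_ket_left (s : ℕ × ℕ) (y : Fock) : fockInner (ket s) y = y s := by
  simp [fockInner]

theorem fockInner_ket_right (x : Fock) (s : ℕ × ℕ) :
    fockInner x (ket s) = (starRingEnd ℂ) (x s) := by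
  classical
  simp [fockInner, Finsupp.sum, Finsupp.single_apply]
  intro h
  simp [h]

theorem dagger_eq {A B : FockOp} (h : IsAdjoint A B) : dagger A = B := by
  have h0 : ∃ B, IsAdjoint A B := ⟨B, h⟩
  have h1 : IsAdjoint A (dagger A) := by
    simp only [dagger, dif_pos h0]
    exact h0.choose_spec
  apply op_ext
  intro s
  ext t
  have h2 := (h1 (ket s) (ket t)).trans (h (ket s) (ket t)).symm
  simp only [fockInner_ket_right] at h2
  exact (starRingEnd ℂ).injective h2

theorem fockInner_add_left (x x' y : Fock) :
    fockInner (x + x') y = fockInner x y + fockInner x' y := by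
  classical
  simp only [fockInner]
  exact Finsupp.sum_add_index' (by simp) (by intros; simp [add_mul])

theorem fockInner_add_right (x y y' : Fock) :
    fockInner x (y + y') = fockInner x y + fockInner x y' := by
  simp only [fockInner, Finsupp.sum, Finsupp.add_apply, mul_add, Finset.sum_add_distrib]

theorem fockInner_smul_left (c : ℂ) (x y : Fock) :
    fockInner (c • x) y = (starRingEnd ℂ) c * fockInner x y := by
  simp only [fockInner]
  rw [Finsupp.sum_smul_index' (by simp)]
  simp [Finsupp.sum, Finset.mul_sum, mul_assoc]

theorem fockInner_smul_right (c : ℂ) (x y : Fock) :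
    fockInner x (c • y) = c * fockInner x y := by
  simp only [fockInner, Finsupp.sum, Finsupp.smul_apply, smul_eq_mul, Finset.mul_sum]
  exact Finset.sum_congr rfl fun _ _ => by ring

theorem isAdjoint_of_ket {A B : FockOp}
    (h : ∀ s t, fockInner (B (ket s)) (ket t) = fockInner (ket s) (A (ket t))) :
    IsAdjoint A B := by
  intro x y
  induction x using Finsupp.induction_linear with
  | zero => simp [fockInner]
  | add x x' hx hx' => simp only [map_add, fockInner_add_left, hx, hx']
  | single s c =>
    rw [← mul_one c, ← smul_eq_mul, ← Finsupp.smul_single]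
    simp only [map_smul, fockInner_smul_left]
    congr 1
    induction y using Finsupp.induction_linear with
    | zero => simp [fockInner]
    | add y y' hy hy' => simp only [map_add, fockInner_add_right, hy, hy']
    | single t d =>
      rw [← mul_one d, ← smul_eq_mul, ← Finsupp.smul_single]
      simp only [map_smul, fockInner_smul_right]
      rw [h]

theorem isAdjoint_zero : IsAdjoint 0 0 := fun x y => by simp [fockInner]

theorem IsAdjoint.smul {A B : FockOp} (h : IsAdjoint A B) (c : ℂ) :
    IsAdjoint (c • A) ((starRingEnd ℂ) c • B) := fun x y => by
  simp [fockInner_smul_left, fockInner_smul_right, h x y]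

theorem isAdjoint_K (q : DeformParam) : IsAdjoint (jordanGen q .K) (jordanGen q .K) := by
  refine isAdjoint_of_ket fun s t => ?_
  rw [fockInner_ket_left, fockInner_ket_right, jordan_K, jordan_K]
  by_cases h : s = t
  · subst h
    simp [qpow]
  · simp [h, Ne.symm h]

theorem isAdjoint_Kinv (q : DeformParam) :
    IsAdjoint (jordanGen q .Kinv) (jordanGen q .Kinv) := by
  refine isAdjoint_of_ket fun s t => ?_
  rw [fockInner_ket_left, fockInner_ket_right, jordan_Kinv, jordan_Kinv]
  by_cases h : s = t
  · subst h
    simp [qpow]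
  · simp [h, Ne.symm h]

theorem isAdjoint_Jp (q : DeformParam) : IsAdjoint (jordanGen q .Jp) (jordanGen q .Jm) := by
  refine isAdjoint_of_ket fun s t => ?_
  obtain ⟨m, n⟩ := s
  obtain ⟨k, l⟩ := t
  rw [fockInner_ket_left, fockInner_ket_right]
  rcases m with _ | m <;> rcases l with _ | l
  · simp [jordan_Jm_zero, jordan_Jp_zero]
  · simp [jordan_Jm_zero, jordan_Jp_succ]
  · simp [jordan_Jm_succ, jordan_Jp_zero]
  · rw [jordan_Jm_succ, jordan_Jp_succ]
    by_cases h : m = k ∧ n = l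
    · obtain ⟨rfl, rfl⟩ := h
      simp
    · have h1 : ¬ (k = m ∧ l = n) := fun h2 => h ⟨h2.1.symm, h2.2.symm⟩
      simp [h, h1]

/-! ### Quantum fluxes and quantum spinors

The two values `-` and `+` of a spinor index are `0` and `1` of `Fin 2`. -/

/-- The quantum flux `L̃`, a lower triangular matrix with entries in `U_q(su(2))`. -/
def flux (q : DeformParam) : Matrix (Fin 2) (Fin 2) (Uq q) :=
  !![gen q .K, 0;
     (qpow q (-(1 / 4)) * (qpow q (1 / 2) - qpow q (-(1 / 2)))) • gen q .Jp, gen q .Kinv]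

/-- `L̃` as a matrix of operators on the Fock space. -/
def fluxOp (q : DeformParam) : Matrix (Fin 2) (Fin 2) FockOp := (flux q).map (jordan q)

/-- `S(L̃)` (the antipode applied to every entry) as a matrix of operators on the Fock space. -/
def antipodeFluxOp (q : DeformParam) : Matrix (Fin 2) (Fin 2) FockOp :=
  ((flux q).map (antipode q)).map (jordan q)

/-- `M†` for a matrix `M` of operators: `(M†)_A^B = (M_B^A)†`. -/
def matDagger (M : Matrix (Fin 2) (Fin 2) FockOp) : Matrix (Fin 2) (Fin 2) FockOp :=
  M.transpose.map dagger

theorem fluxOp_eq (q : DeformParam) : fluxOp q =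
    !![jordanGen q .K, 0;
      (qpow q (-(1 / 4)) * (qpow q (1 / 2) - qpow q (-(1 / 2)))) • jordanGen q .Jp,
        jordanGen q .Kinv] := by
  ext i j : 2
  fin_cases i <;> fin_cases j <;> simp [fluxOp, flux]

theorem antipodeFluxOp_eq (q : DeformParam) : antipodeFluxOp q =
    !![jordanGen q .Kinv, 0;
      (-(qpow q (1 / 4) * (qpow q (1 / 2) - qpow q (-(1 / 2))))) • jordanGen q .Jp,
        jordanGen q .K] := by
  have h1 : qpow q (-(1 / 4)) * qpow q (1 / 2) = qpow q (1 / 4) := by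
    rw [← qpow_add]
    norm_num
  have h0 : antipode q 0 = 0 := by simp [antipode]
  have h2 : ∀ (c : ℂ) (x : Uq q), antipode q (c • x) = c • antipode q x := by
    intro c x
    simp [antipode]
  ext i j : 2
  fin_cases i <;> fin_cases j <;>
    simp only [antipodeFluxOp, flux, Matrix.map_apply, Matrix.of_apply, Matrix.cons_val',
      Matrix.cons_val_zero, Matrix.cons_val_one, Matrix.cons_val_fin_one, Fin.zero_eta,
      Fin.mk_one, h0, h2, antipode_gen, antipodeGen, MulOpposite.unop_op, map_smul, map_zero,
      jordan_gen, smul_smul]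
  congr 1
  rw [← h1]
  ring_nf

/-- The sign `ε = ±` that distinguishes a spinor from its dual. -/
inductive SpinSign : Type
  | minus | plus

/-- The spinor `τ̃^ε` (the `U_{q⁻¹}(su(2))` spinor):
`τ̃^- = (q^{-N_b/4} a, q^{N_a/4} b)`, `τ̃^+ = (-b† q^{(N_a+1)/4}, a† q^{-(N_b+1)/4})`. -/
def tauSpinor (q : DeformParam) : SpinSign → Fin 2 → FockOp
  | .minus => ![qpowN q (fun _ y => -(y / 4)) * aOp q, qpowN q (fun x _ => x / 4) * bOp q]
  | .plus => ![-(bDag q * qpowN q (fun x _ => (x + 1) / 4)),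
      aDag q * qpowN q (fun _ y => -((y + 1) / 4))]

/-- The spinor `t̃^ε` (the `U_q(su(2))` spinor):
`t̃^- = (q^{N_b/4} a, q^{-N_a/4} b)`, `t̃^+ = (-b† q^{-(N_a+1)/4}, a† q^{(N_b+1)/4})`. -/
def tSpinor (q : DeformParam) : SpinSign → Fin 2 → FockOp
  | .minus => ![qpowN q (fun _ y => y / 4) * aOp q, qpowN q (fun x _ => -(x / 4)) * bOp q]
  | .plus => ![-(bDag q * qpowN q (fun x _ => -((x + 1) / 4))),
      aDag q * qpowN q (fun _ y => (y + 1) / 4)]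

/-! ### Several ribbons -/

/-- The Fock space of `N` ribbons. -/
abbrev Vertex (N : ℕ) : Type := ⨂[ℂ] _ : Fin N, Fock

/-- The occupation number basis of the Fock space of `N` ribbons. -/
def vertexBasis (N : ℕ) : Module.Basis (Fin N → ℕ × ℕ) ℂ (Vertex N) :=
  Basis.piTensorProduct fun _ => Finsupp.basisSingleOne

/-- `id ⊗ ⋯ ⊗ A ⊗ ⋯ ⊗ id` with `A` on the ribbon `k`. -/
def leg {N : ℕ} (k : Fin N) (A : FockOp) : Module.End ℂ (Vertex N) :=
  PiTensorProduct.map (Function.update (fun _ => LinearMap.id) k A)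

/-- The eigenvalue `(n_a - n_b) / 2` of `J_z`. -/
def magnetic (s : ℕ × ℕ) : ℝ := ((s.1 : ℝ) - s.2) / 2

/-- `q^{J_z ⊗ J_z}`, the first factor on the ribbon `i` and the second on the ribbon `j`. -/
def qJzJz (q : DeformParam) {N : ℕ} (i j : Fin N) : Module.End ℂ (Vertex N) :=
  (vertexBasis N).constr ℂ fun ν =>
    qpow q (magnetic (ν i) * magnetic (ν j)) • vertexBasis N ν

/-- The `n`-th term `(1 - q⁻¹)^n / [n]! q^{n(n-1)/4} (K J_+)^n ⊗ (K⁻¹ J_-)^n` of the `R`-matrix,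
the first factor on the ribbon `i` and the second on the ribbon `j`. -/
def rTerm (q : DeformParam) {N : ℕ} (i j : Fin N) (n : ℕ) : Module.End ℂ (Vertex N) :=
  (((1 - q.1⁻¹) ^ n / qfactorial q n : ℝ) * qpow q ((n : ℝ) * ((n : ℝ) - 1) / 4)) •
    (leg i (jordan q ((gen q .K * gen q .Jp) ^ n)) *
      leg j (jordan q ((gen q .Kinv * gen q .Jm) ^ n)))

/-- The universal `R`-matrix
`R_{ij} = q^{J_z ⊗ J_z} ∑_n (1 - q⁻¹)^n / [n]! q^{n(n-1)/4} (K J_+)^n ⊗ (K⁻¹ J_-)^n`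
acting on `N` ribbons, with first factor on the ribbon `i` and second factor on the ribbon `j`.
On every vector only finitely many terms of the sum are nonzero (`rTerm_finite`). -/
def rMatrix (q : DeformParam) {N : ℕ} (i j : Fin N) : Module.End ℂ (Vertex N) :=
  qJzJz q i j * (vertexBasis N).constr ℂ fun ν => ∑ᶠ n : ℕ, rTerm q i j n (vertexBasis N ν)

theorem leg_tprod {N : ℕ} (k : Fin N) (A : FockOp) (x : Fin N → Fock) :
    leg k A (PiTensorProduct.tprod ℂ x) =
      PiTensorProduct.tprod ℂ (Function.update x k (A (x k))) := by
  simp only [leg, PiTensorProduct.map_tprod]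
  congr 1
  ext l : 1
  by_cases h : l = k
  · subst h
    simp
  · simp [h]

theorem KJp_pow_ket (q : DeformParam) (m n : ℕ) :
    (jordan q ((gen q .K * gen q .Jp) ^ (n + 1))) (ket (m, n)) = 0 := by
  induction n generalizing m with
  | zero => simp [jordan_Jp_zero]
  | succ n ih =>
    rw [pow_succ, map_mul, Module.End.mul_apply, map_mul, Module.End.mul_apply, jordan_gen,
      jordan_gen, jordan_Jp_succ, map_smul, jordan_K, map_smul, map_smul, ih, smul_zero, smul_zero]

theorem KJp_pow_ket_of_lt (q : DeformParam) (m : ℕ) {n k : ℕ} (h : n < k) :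
    (jordan q ((gen q .K * gen q .Jp) ^ k)) (ket (m, n)) = 0 := by
  obtain ⟨d, rfl⟩ := Nat.exists_eq_add_of_lt h
  rw [show n + d + 1 = d + (n + 1) by ring, pow_add, map_mul, Module.End.mul_apply, KJp_pow_ket,
    map_zero]

theorem rTerm_basis_eq_zero (q : DeformParam) {N : ℕ} {i j : Fin N} (hij : i ≠ j)
    (ν : Fin N → ℕ × ℕ) {n : ℕ} (h : (ν i).2 < n) : rTerm q i j n (vertexBasis N ν) = 0 := by
  rw [rTerm, LinearMap.smul_apply, Module.End.mul_apply, vertexBasis, Basis.piTensorProduct_apply,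
    leg_tprod, leg_tprod]
  have h1 : (jordan q ((gen q .K * gen q .Jp) ^ n)) (ket (ν i)) = 0 := KJp_pow_ket_of_lt q _ h
  rw [(PiTensorProduct.tprod ℂ).map_coord_zero i, smul_zero]
  simpa [hij] using h1

theorem rTerm_finite (q : DeformParam) {N : ℕ} {i j : Fin N} (hij : i ≠ j) (v : Vertex N) :
    {n : ℕ | rTerm q i j n v ≠ 0}.Finite := by
  have hv : v ∈ Submodule.span ℂ (Set.range (vertexBasis N)) := by
    rw [(vertexBasis N).span_eq]
    trivial
  induction hv using Submodule.span_induction with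
  | mem x hx =>
    obtain ⟨ν, rfl⟩ := hx
    refine (Set.finite_Iic (ν i).2).subset fun n hn => ?_
    by_contra h
    exact hn (rTerm_basis_eq_zero q hij ν (not_le.1 h))
  | zero => simp
  | add x y _ _ hx hy =>
    refine (hx.union hy).subset fun n hn => ?_
    by_contra h
    simp only [Set.mem_union, Set.mem_ofPred_eq, not_or, not_not] at h
    exact hn (by simp [h.1, h.2])
  | smul c x _ hx =>
    refine hx.subset fun n hn => ?_
    by_contra h
    simp only [Set.mem_ofPred_eq, not_not] at h
    exact hn (by simp [h])

theorem rMatrix_apply (q : DeformParam) {N : ℕ} {i j : Fin N} (hij : i ≠ j) (v : Vertex N) :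
    rMatrix q i j v = qJzJz q i j (∑ᶠ n : ℕ, rTerm q i j n v) := by
  rw [rMatrix, Module.End.mul_apply]
  congr 1
  have hv : v ∈ Submodule.span ℂ (Set.range (vertexBasis N)) := by
    rw [(vertexBasis N).span_eq]
    trivial
  induction hv using Submodule.span_induction with
  | mem x hx =>
    obtain ⟨ν, rfl⟩ := hx
    rw [Module.Basis.constr_basis]
  | zero => simp
  | add x y _ _ hx hy =>
    simp only [map_add, hx, hy]
    exact (finsum_add_distrib (rTerm_finite q hij x) (rTerm_finite q hij y)).symm
  | smul c x _ hx =>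
    simp only [map_smul, hx]
    exact smul_finsum' c (rTerm_finite q hij x)

/-! ### Braiding and parallel transport -/

/-- The product `f_1 f_2 ⋯ f_{n-1}` over the ribbons before the ribbon `n`, in increasing order. -/
def prodBefore {N : ℕ} {α : Type*} [Monoid α] (n : Fin N) (f : Fin N → α) : α :=
  (List.ofFn fun k : Fin n.1 => f ⟨k.1, k.2.trans n.2⟩).prod

/-- The product `f_{n-1} ⋯ f_2 f_1` over the ribbons before the ribbon `n`, in decreasing order. -/
def prodBeforeRev {N : ℕ} {α : Type*} [Monoid α] (n : Fin N) (f : Fin N → α) : α :=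
  (List.ofFn fun k : Fin n.1 => f ⟨k.1, k.2.trans n.2⟩).reverse.prod

/-- The parallel transport `(M ⊗ ⋯ ⊗ M ⊗ s)_A ⊗ id ⊗ ⋯ ⊗ id`: the spinor `s` on the ribbon `n`,
multiplied by the product `M_1 M_2 ⋯ M_{n-1}` of the holonomies `M_k` (the `2 × 2` matrix `M` with
its entries acting on the ribbon `k`). -/
def parallelTransport {N : ℕ} (M : Matrix (Fin 2) (Fin 2) FockOp) (s : Fin 2 → FockOp)
    (n : Fin N) (A : Fin 2) : Module.End ℂ (Vertex N) :=
  (prodBefore n fun k => M.map (leg k)).mulVec (fun B => leg n (s B)) A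

/-- The same expression in components, summed over `A_2, …, A_n` with `A_1 = A`:
`∑ M_{A_1}^{A_2} ⊗ M_{A_2}^{A_3} ⊗ ⋯ ⊗ M_{A_{n-1}}^{A_n} ⊗ s_{A_n} ⊗ id ⊗ ⋯ ⊗ id`. -/
def transportComponents {N : ℕ} (M : Matrix (Fin 2) (Fin 2) FockOp) (s : Fin 2 → FockOp)
    (n : Fin N) (A : Fin 2) : Module.End ℂ (Vertex N) :=
  ∑ p : Fin (n.1 + 1) → Fin 2 with p 0 = A,
    PiTensorProduct.map fun k : Fin N =>
      if h : k < n then M (p ⟨k.1, Nat.lt_succ_of_lt h⟩) (p ⟨k.1 + 1, Nat.succ_lt_succ h⟩)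
      else if k = n then s (p (Fin.last n.1))
      else LinearMap.id

end QRibbon

end

/-! Everything reduces to two ribbons. Up to the diagonal factor `q^{J_z ⊗ J_z}`, the `R`-matrix is
a series `U = ∑ c_m X^m` in the single operator `X = K J_+ ⊗ K⁻¹ J_-`, which is locally nilpotent on
the Fock space. The coefficients satisfy `c_{m+1} (1 + p + ⋯ + p^m) = κ c_m` with `p = q⁻¹` and `κ =
1 - q⁻¹` (`rCoeff_succ_mul`), so `U` is a `p`-exponential. If `P X = X P + γ Q` and `Q X = p X Q`,
normal ordering of `P X^{m+1}` produces exactly the factor `1 + ⋯ + p^m`, the series resums, and `P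
U = U (P + γ κ Q)`: the braiding has one correction term (`IsLocalSeries.mul_eq`,
`IsLocalSeries.eq_mul`).

The spinors fit this pattern: of the two components, one commutes with `X`, possibly after being
multiplied by a power of `K` on the other ribbon, and the other picks up a multiple of the first
(`tauSpinor_relations`, `tSpinor_relations`). The factor `q^{J_z ⊗ J_z}` is moved past homogeneous
operators by counting weights and supplies the powers of `K` (`qJzJz_mul_leg_mul_leg`). The
constants `γ κ` are the off-diagonal coefficients of `L̃` and `S(L̃)`, so one braiding is
multiplication by one flux matrix.

For several ribbons, each further conjugation commutes with the fluxes already produced on other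
ribbons and acts only on the spinor, which inserts a new matrix next to it
(`reverse_prod_mul_mul_prod`). -/

noncomputable section

namespace QRibbon

/-! ### Series in a locally nilpotent operator -/

section LocalSeries

variable {V : Type*} [AddCommMonoid V] [Module ℂ V]

/-- `U = ∑ c_m X^m` for a locally nilpotent operator `X`. -/
structure IsLocalSeries (c : ℕ → ℂ) (X U : Module.End ℂ V) : Prop where
  nilpotent : ∀ v, ∃ M, (X ^ M) v = 0
  apply_eq : ∀ v M, (X ^ M) v = 0 → U v = ∑ m ∈ Finset.range M, c m • (X ^ m) v

theorem pow_apply_eq_zero_of_le {X : Module.End ℂ V} {v : V} {M M' : ℕ} (h : M ≤ M')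
    (hv : (X ^ M) v = 0) : (X ^ M') v = 0 := by
  obtain ⟨d, rfl⟩ := Nat.exists_eq_add_of_le' h
  rw [pow_add, Module.End.mul_apply, hv, map_zero]

/-- Normal ordering of a power of `X` and an operator whose commutator with `X` is a multiple of an
operator `Q` that commutes with `X` up to a factor `p`. -/
theorem mul_pow_of_mul_eq {A : Type*} [Semiring A] [Algebra ℂ A] {P Q X : A} {γ p : ℂ}
    (hP : P * X = X * P + γ • Q) (hQ : Q * X = p • (X * Q)) (m : ℕ) :
    P * X ^ (m + 1) =
      X ^ (m + 1) * P + (γ * ∑ i ∈ Finset.range (m + 1), p ^ i) • (X ^ m * Q) := by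
  have hQm : ∀ k : ℕ, Q * X ^ k = p ^ k • (X ^ k * Q) := by
    intro k
    induction k with
    | zero => simp
    | succ k ih =>
      rw [pow_succ, ← mul_assoc, ih, smul_mul_assoc, mul_assoc, hQ, mul_smul_comm, smul_smul,
        ← mul_assoc, pow_succ]
  induction m with
  | zero => simpa using hP
  | succ m ih =>
    rw [pow_succ' X (m + 1), ← mul_assoc, hP, add_mul, mul_assoc, ih, smul_mul_assoc, hQm,
      mul_add, ← mul_assoc, mul_smul_comm, ← mul_assoc, ← pow_succ' X m, smul_smul, add_assoc,
      ← add_smul, Finset.sum_range_succ _ (m + 1)]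
    congr 2
    ring

/-- Mirror image of `mul_pow_of_mul_eq`, read in the opposite algebra. -/
theorem pow_mul_of_mul_eq {A : Type*} [Semiring A] [Algebra ℂ A] {P Q X : A} {γ p : ℂ}
    (hP : X * P = P * X + γ • Q) (hQ : X * Q = p • (Q * X)) (m : ℕ) :
    X ^ (m + 1) * P =
      P * X ^ (m + 1) + (γ * ∑ i ∈ Finset.range (m + 1), p ^ i) • (Q * X ^ m) := by
  have h := mul_pow_of_mul_eq (A := Aᵐᵒᵖ) (P := .op P) (Q := .op Q) (X := .op X) (γ := γ) (p := p)
    (by simpa using congrArg MulOpposite.op hP) (by simpa using congrArg MulOpposite.op hQ) m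
  simpa using congrArg MulOpposite.unop h

variable {c : ℕ → ℂ} {X U : Module.End ℂ V}

/-- A `q`-exponential series moves an operator past itself up to a correction. -/
theorem IsLocalSeries.mul_eq (h : IsLocalSeries c X U) {p κ γ : ℂ}
    (hc : ∀ m, c (m + 1) * ∑ i ∈ Finset.range (m + 1), p ^ i = κ * c m)
    {P Q : Module.End ℂ V} (hP : P * X = X * P + γ • Q) (hQ : Q * X = p • (X * Q)) :
    P * U = U * (P + (γ * κ) • Q) := by
  ext v
  obtain ⟨M₁, h₁⟩ := h.nilpotent v
  obtain ⟨M₂, h₂⟩ := h.nilpotent (P v)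
  obtain ⟨M₃, h₃⟩ := h.nilpotent (Q v)
  -- One truncation must serve `v`, `P v` and `Q v`. The `P`-series is cut at `M + 1` and the
  -- `Q`-series at `M`, since the correction from `X^(m+1)` carries only `X^m`.
  set M := M₁ + M₂ + M₃
  have e₁ := h.apply_eq v (M + 1) (pow_apply_eq_zero_of_le (by omega) h₁)
  have e₂ := h.apply_eq (P v) (M + 1) (pow_apply_eq_zero_of_le (by omega) h₂)
  have e₃ := h.apply_eq (Q v) M (pow_apply_eq_zero_of_le (by omega) h₃)
  simp only [Module.End.mul_apply, LinearMap.add_apply, LinearMap.smul_apply, map_add, map_smul,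
    e₁, e₂, e₃, map_sum, Finset.smul_sum]
  rw [Finset.sum_range_succ', Finset.sum_range_succ' _ M, add_right_comm,
    ← Finset.sum_add_distrib]
  congr 1
  refine Finset.sum_congr rfl fun m _ => ?_
  have := LinearMap.congr_fun (mul_pow_of_mul_eq hP hQ m) v
  simp only [Module.End.mul_apply, LinearMap.add_apply, LinearMap.smul_apply] at this
  rw [this, smul_add, smul_smul, smul_smul, mul_assoc, ← hc]
  congr 2
  ring

/-- The opposite algebra does not help here: local nilpotency concerns vectors and is not symmetric
under reversal of products. The argument of `mul_eq` is repeated with `P` and `Q` acting after the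
series, so only `v` and `P v` need a truncation. -/
theorem IsLocalSeries.eq_mul (h : IsLocalSeries c X U) {p κ γ : ℂ}
    (hc : ∀ m, c (m + 1) * ∑ i ∈ Finset.range (m + 1), p ^ i = κ * c m)
    {P Q : Module.End ℂ V} (hP : X * P = P * X + γ • Q) (hQ : X * Q = p • (Q * X)) :
    U * P = (P + (γ * κ) • Q) * U := by
  ext v
  obtain ⟨M₁, h₁⟩ := h.nilpotent v
  obtain ⟨M₂, h₂⟩ := h.nilpotent (P v)
  set M := M₁ + M₂
  have e₁ := h.apply_eq v (M + 1) (pow_apply_eq_zero_of_le (by omega) h₁)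
  have e₁' := h.apply_eq v M (pow_apply_eq_zero_of_le (by omega) h₁)
  have e₂ := h.apply_eq (P v) (M + 1) (pow_apply_eq_zero_of_le (by omega) h₂)
  rw [Module.End.mul_apply, e₂, Module.End.mul_apply, LinearMap.add_apply, LinearMap.smul_apply,
    congrArg P e₁, congrArg Q e₁']
  simp only [map_sum, map_smul, Finset.smul_sum]
  rw [Finset.sum_range_succ', Finset.sum_range_succ' _ M, add_right_comm,
    ← Finset.sum_add_distrib]
  congr 1
  refine Finset.sum_congr rfl fun m _ => ?_
  have := LinearMap.congr_fun (pow_mul_of_mul_eq hP hQ m) v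
  simp only [Module.End.mul_apply, LinearMap.add_apply, LinearMap.smul_apply] at this
  rw [this, smul_add, smul_smul, smul_smul, mul_assoc, ← hc]
  congr 2
  ring

/-- An operator commuting with `X` preserves the kernel of every `X ^ M`, so a truncation valid for
`v` is valid for `P v`. -/
theorem IsLocalSeries.commute (h : IsLocalSeries c X U) {P : Module.End ℂ V}
    (hP : Commute P X) : Commute P U := by
  ext v
  obtain ⟨M₁, h₁⟩ := h.nilpotent v
  have h₂ : (X ^ M₁) (P v) = 0 := by
    rw [← Module.End.mul_apply, ← (hP.pow_right M₁).eq, Module.End.mul_apply, h₁, map_zero]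
  rw [Module.End.mul_apply, Module.End.mul_apply, h.apply_eq v M₁ h₁, h.apply_eq _ M₁ h₂, map_sum]
  refine Finset.sum_congr rfl fun m _ => ?_
  rw [map_smul, ← Module.End.mul_apply, (hP.pow_right m).eq, Module.End.mul_apply]

/-- With `c 0 = 1`, `U` is the identity plus terms divisible by `X`, hence unipotent on the kernel
of each `X ^ M`. Both halves are inductions on `M`. -/
theorem IsLocalSeries.isUnit (h : IsLocalSeries c X U) (hc : c 0 = 1) : IsUnit U := by
  -- Scalar multiplication by `-1` gives the negation needed to form `v - U v`.
  let _ := Module.addCommMonoidToAddCommGroup ℂ (M := V)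
  rw [Module.End.isUnit_iff]
  have hXU : Commute X U := h.commute (Commute.refl X)
  constructor
  · rw [injective_iff_map_eq_zero]
    intro v hv
    obtain ⟨M, hM⟩ := h.nilpotent v
    induction M generalizing v with
    | zero => simpa using hM
    | succ M ih =>
      have hXv : X v = 0 := by
        refine ih (X v) ?_ (by rw [← Module.End.mul_apply, ← pow_succ, hM])
        rw [← Module.End.mul_apply, ← hXU.eq, Module.End.mul_apply, hv, map_zero]
      have := h.apply_eq v 1 (by simpa using hXv)
      simpa [hc, hv] using this.symm
  · intro v
    obtain ⟨M, hM⟩ := h.nilpotent v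
    induction M generalizing v with
    | zero => exact ⟨0, by simpa using hM.symm⟩
    | succ M ih =>
      -- Every term of `v - U v` contains a factor `X`, so `X ^ M` already kills it. A preimage `w`
      -- of it gives the preimage `w + v` of `v`.
      obtain ⟨w, hw⟩ := ih (v - U v) (by
        rw [h.apply_eq v (M + 1) hM, Finset.sum_range_succ', hc]
        simp only [pow_zero, one_smul, Module.End.one_apply, sub_add_cancel_right, map_neg,
          map_sum, map_smul, neg_eq_zero]
        refine Finset.sum_eq_zero fun m _ => ?_
        rw [← Module.End.mul_apply, ← pow_add,
          pow_apply_eq_zero_of_le (by omega : M + 1 ≤ M + (m + 1)) hM, smul_zero])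
      exact ⟨w + v, by rw [map_add, hw, sub_add_cancel]⟩

end LocalSeries

/-! ### Normal ordering of `q`-boson operators -/

/-- The function `f(N_a, N_b)` of the number operators. -/
def diagOp (f : ℝ → ℝ → ℂ) : FockOp := opOfKet fun s => f s.1 s.2 • ket s

theorem qpowN_eq_diagOp (q : DeformParam) (f : ℝ → ℝ → ℝ) :
    qpowN q f = diagOp fun x y => qpow q (f x y) := rfl

theorem diagOp_ket (f : ℝ → ℝ → ℂ) (s : ℕ × ℕ) : diagOp f (ket s) = f s.1 s.2 • ket s := by
  simp [diagOp, -Finsupp.smul_single]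

theorem diagOp_mul (f g : ℝ → ℝ → ℂ) : diagOp f * diagOp g = diagOp fun x y => f x y * g x y := by
  refine op_ext fun s => ?_
  simp [diagOp_ket, smul_smul, mul_comm, -Finsupp.smul_single]

theorem smul_diagOp (c : ℂ) (f : ℝ → ℝ → ℂ) : c • diagOp f = diagOp fun x y => c * f x y := by
  refine op_ext fun s => ?_
  simp [diagOp_ket, smul_smul, -Finsupp.smul_single]

theorem diagOp_add (f g : ℝ → ℝ → ℂ) : diagOp f + diagOp g = diagOp fun x y => f x y + g x y := by
  refine op_ext fun s => ?_
  simp only [LinearMap.add_apply, diagOp_ket, add_smul]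

theorem neg_diagOp_mul (f : ℝ → ℝ → ℂ) (X : FockOp) :
    -(diagOp f * X) = diagOp (fun x y => -f x y) * X := by
  have h : -diagOp f = diagOp fun x y => -f x y := by
    refine op_ext fun s => ?_
    simp only [LinearMap.neg_apply, diagOp_ket, neg_smul]
  rw [← h]
  rfl

/-- This and the following rules bring any word in the `q`-bosons to the form `f(N_a, N_b)` times an
ordered word, so that an operator identity becomes an identity of coefficient functions. At `n_a =
0` the truncated `0 - 1` is harmless because its coefficient is `√[0] = 0`. -/
theorem aOp_mul_diagOp (q : DeformParam) (f : ℝ → ℝ → ℂ) :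
    aOp q * diagOp f = diagOp (fun x y => f (x + 1) y) * aOp q := by
  refine op_ext ?_
  rintro ⟨_ | m, n⟩ <;> simp [aOp, diagOp_ket, mul_comm, smul_smul,
    -Finsupp.smul_single, -Complex.coe_smul]

theorem bOp_mul_diagOp (q : DeformParam) (f : ℝ → ℝ → ℂ) :
    bOp q * diagOp f = diagOp (fun x y => f x (y + 1)) * bOp q := by
  refine op_ext ?_
  rintro ⟨m, _ | n⟩ <;> simp [bOp, diagOp_ket, mul_comm, smul_smul,
    -Finsupp.smul_single, -Complex.coe_smul]

theorem aDag_mul_diagOp (q : DeformParam) (f : ℝ → ℝ → ℂ) :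
    aDag q * diagOp f = diagOp (fun x y => f (x - 1) y) * aDag q := by
  refine op_ext ?_
  rintro ⟨m, n⟩
  simp [aDag, diagOp_ket, mul_comm, smul_smul,
    -Finsupp.smul_single, -Complex.coe_smul]

theorem bDag_mul_diagOp (q : DeformParam) (f : ℝ → ℝ → ℂ) :
    bDag q * diagOp f = diagOp (fun x y => f x (y - 1)) * bDag q := by
  refine op_ext ?_
  rintro ⟨m, n⟩
  simp [bDag, diagOp_ket, mul_comm, smul_smul,
    -Finsupp.smul_single, -Complex.coe_smul]

theorem bOp_mul_aOp (q : DeformParam) : bOp q * aOp q = aOp q * bOp q := by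
  refine op_ext fun s => ?_
  simp [aOp, bOp, mul_comm, smul_smul,
    -Finsupp.smul_single, -Complex.coe_smul]

theorem bOp_mul_aDag (q : DeformParam) : bOp q * aDag q = aDag q * bOp q := by
  refine op_ext fun s => ?_
  simp [aDag, bOp, mul_comm, smul_smul,
    -Finsupp.smul_single, -Complex.coe_smul]

theorem bDag_mul_aOp (q : DeformParam) : bDag q * aOp q = aOp q * bDag q := by
  refine op_ext fun s => ?_
  simp [aOp, bDag, mul_comm, smul_smul,
    -Finsupp.smul_single, -Complex.coe_smul]

theorem bDag_mul_aDag (q : DeformParam) : bDag q * aDag q = aDag q * bDag q := by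
  refine op_ext fun s => ?_
  simp [aDag, bDag, mul_comm, smul_smul,
    -Finsupp.smul_single, -Complex.coe_smul]

theorem aOp_mul_aDag (q : DeformParam) :
    aOp q * aDag q = diagOp fun x _ => (qnum q (x + 1) : ℂ) := by
  refine op_ext fun s => ?_
  simp [aDag, aOp, diagOp_ket, sqrt_qnum_sq, smul_smul,
    -Finsupp.smul_single, -Complex.coe_smul]

theorem bOp_mul_bDag (q : DeformParam) :
    bOp q * bDag q = diagOp fun _ y => (qnum q (y + 1) : ℂ) := by
  refine op_ext fun s => ?_
  simp [bDag, bOp, diagOp_ket, sqrt_qnum_sq, smul_smul,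
    -Finsupp.smul_single, -Complex.coe_smul]

theorem aDag_mul_aOp (q : DeformParam) : aDag q * aOp q = diagOp fun x _ => (qnum q x : ℂ) := by
  refine op_ext ?_
  rintro ⟨_ | m, n⟩ <;> simp [aDag, aOp, diagOp_ket, sqrt_qnum_sq, smul_smul,
    -Finsupp.smul_single, -Complex.coe_smul]

theorem bDag_mul_bOp (q : DeformParam) : bDag q * bOp q = diagOp fun _ y => (qnum q y : ℂ) := by
  refine op_ext ?_
  rintro ⟨m, _ | n⟩ <;> simp [bDag, bOp, diagOp_ket, sqrt_qnum_sq, smul_smul,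
    -Finsupp.smul_single, -Complex.coe_smul]

/-- Lets a rule for `x * y` fire inside a right-associated word. -/
theorem mul_mul_eq_of_mul_eq {A : Type*} [Semigroup A] {x y z : A} (h : x * y = z) (t : A) :
    x * (y * t) = z * t := by rw [← mul_assoc, h]

/-! ### Scalars -/

theorem qpow_ne_zero (q : DeformParam) (x : ℝ) : qpow q x ≠ 0 := by
  simp [qpow, (Real.rpow_pos_of_pos q.2.1 x).ne']

theorem qpow_neg (q : DeformParam) (x : ℝ) : qpow q (-x) = (qpow q x)⁻¹ := by
  simp [qpow, Real.rpow_neg q.2.1.le]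

theorem qpow_sub (q : DeformParam) (x y : ℝ) : qpow q (x - y) = qpow q x * (qpow q y)⁻¹ := by
  rw [sub_eq_add_neg, qpow_add, qpow_neg]

theorem qpow_nat_mul (q : DeformParam) (n : ℕ) (x : ℝ) : qpow q (n * x) = qpow q x ^ n := by
  simp [qpow, mul_comm (n : ℝ), Real.rpow_mul q.2.1.le]

/-- All exponents in the spinors are multiples of quarters, so in the variables `q^{1/4}` and
`q^{x/4}` every coefficient becomes a rational function. -/
theorem ofReal_qnum (q : DeformParam) (x : ℝ) : (qnum q x : ℂ) =
    (qpow q (x / 4) ^ 2 - (qpow q (x / 4) ^ 2)⁻¹) /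
      (qpow q (1 / 4) ^ 2 - (qpow q (1 / 4) ^ 2)⁻¹) := by
  have h : ∀ y : ℝ, qpow q (y / 4) ^ 2 = qpow q (y / 2) := by
    intro y
    rw [← qpow_nat_mul]
    congr 1
    push_cast
    ring
  rw [h, h, ← qpow_neg, ← qpow_neg]
  simp [qnum, qpow]

theorem qpow_quarter_pow_ne_one (q : DeformParam) : qpow q (1 / 4) ^ 4 - 1 ≠ 0 := by
  rw [← qpow_nat_mul, sub_ne_zero]
  norm_num [qpow]
  exact q.2.2

theorem qpow_half (q : DeformParam) : qpow q (1 / 2) = qpow q (1 / 4) ^ 2 := by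
  rw [← qpow_nat_mul]; congr 1; norm_num

theorem qpow_three_quarters (q : DeformParam) : qpow q (3 / 4) = qpow q (1 / 4) ^ 3 := by
  rw [← qpow_nat_mul]; congr 1; norm_num

/-! ### Spinors and the generators -/

-- The first two relations serve a spinor on the second leg of `R`, where it meets `K⁻¹ J_-`; the
-- last two serve the first leg, where it meets `K J_+`. Each is checked by normal ordering.
set_option linter.unusedSimpArgs false in
theorem tauSpinor_relations (q : DeformParam) (ε : SpinSign) :
    (tauSpinor q ε 0 * (jordanGen q .Kinv * jordanGen q .Jm) =
      qpow q (-(1 / 2)) • (jordanGen q .Kinv * jordanGen q .Jm * tauSpinor q ε 0)) ∧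
    (tauSpinor q ε 1 * (jordanGen q .Kinv * jordanGen q .Jm) =
      qpow q (1 / 2) • (jordanGen q .Kinv * jordanGen q .Jm * tauSpinor q ε 1) +
        qpow q (1 / 4) • tauSpinor q ε 0) ∧
    (tauSpinor q ε 1 * (jordanGen q .K * jordanGen q .Jp) =
      jordanGen q .K * jordanGen q .Jp * tauSpinor q ε 1) ∧
    (jordanGen q .K * jordanGen q .Jp * tauSpinor q ε 0 =
      tauSpinor q ε 0 * (jordanGen q .K * jordanGen q .Jp) +
        (-qpow q (3 / 4)) • (tauSpinor q ε 1 * (jordanGen q .K * jordanGen q .K))) := by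
  have h1 := qpow_ne_zero q (1 / 4)
  have h2 := qpow_quarter_pow_ne_one q
  refine ⟨?_, ?_, ?_, ?_⟩ <;> cases ε <;>
    simp only [tauSpinor, jordanGen, qpowN_eq_diagOp, Matrix.cons_val_zero, Matrix.cons_val_one,
      mul_assoc, aOp_mul_diagOp, bOp_mul_diagOp, aDag_mul_diagOp, bDag_mul_diagOp, bOp_mul_aOp,
      bOp_mul_aDag, bDag_mul_aOp, bDag_mul_aDag, aOp_mul_aDag, aDag_mul_aOp, bOp_mul_bDag,
      bDag_mul_bOp, mul_mul_eq_of_mul_eq (aOp_mul_diagOp q _),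
      mul_mul_eq_of_mul_eq (bOp_mul_diagOp q _), mul_mul_eq_of_mul_eq (aDag_mul_diagOp q _),
      mul_mul_eq_of_mul_eq (bDag_mul_diagOp q _), mul_mul_eq_of_mul_eq (bOp_mul_aOp q),
      mul_mul_eq_of_mul_eq (bOp_mul_aDag q), mul_mul_eq_of_mul_eq (bDag_mul_aOp q),
      mul_mul_eq_of_mul_eq (bDag_mul_aDag q), mul_mul_eq_of_mul_eq (aOp_mul_aDag q),
      mul_mul_eq_of_mul_eq (aDag_mul_aOp q), mul_mul_eq_of_mul_eq (bOp_mul_bDag q),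
      mul_mul_eq_of_mul_eq (bDag_mul_bOp q), diagOp_mul, mul_mul_eq_of_mul_eq (diagOp_mul _ _),
      neg_diagOp_mul, ← smul_mul_assoc, smul_diagOp, ← add_mul, diagOp_add] <;>
    -- The ordered words agree, leaving the coefficient functions. These are equal for all real `x`,
    -- `y`, not only for occupation numbers.
    congr 2 <;> funext x y <;>
    have hx := qpow_ne_zero q (x / 4) <;>
    have hy := qpow_ne_zero q (y / 4) <;>
    simp only [sub_div, add_div, neg_sub, qpow_sub, qpow_add, qpow_neg, ofReal_qnum, qpow_half,
      qpow_three_quarters] <;>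
    field_simp <;> ring

-- Compared with `τ̃`, the roles of `J_+` and `J_-`, and of the two components, are interchanged.
set_option linter.unusedSimpArgs false in
theorem tSpinor_relations (q : DeformParam) (ε : SpinSign) :
    (tSpinor q ε 0 * (jordanGen q .Kinv * jordanGen q .Jm) =
      jordanGen q .Kinv * jordanGen q .Jm * tSpinor q ε 0) ∧
    (jordanGen q .Kinv * jordanGen q .Jm * tSpinor q ε 1 =
      tSpinor q ε 1 * (jordanGen q .Kinv * jordanGen q .Jm) +
        (-qpow q (3 / 4)) • (tSpinor q ε 0 * (jordanGen q .Kinv * jordanGen q .Kinv))) ∧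
    (tSpinor q ε 1 * (jordanGen q .K * jordanGen q .Jp) =
      qpow q (-(1 / 2)) • (jordanGen q .K * jordanGen q .Jp * tSpinor q ε 1)) ∧
    (tSpinor q ε 0 * (jordanGen q .K * jordanGen q .Jp) =
      qpow q (1 / 2) • (jordanGen q .K * jordanGen q .Jp * tSpinor q ε 0) +
        qpow q (1 / 4) • tSpinor q ε 1) := by
  have h1 := qpow_ne_zero q (1 / 4)
  have h2 := qpow_quarter_pow_ne_one q
  refine ⟨?_, ?_, ?_, ?_⟩ <;> cases ε <;>
    simp only [tSpinor, jordanGen, qpowN_eq_diagOp, Matrix.cons_val_zero, Matrix.cons_val_one,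
      mul_assoc, aOp_mul_diagOp, bOp_mul_diagOp, aDag_mul_diagOp, bDag_mul_diagOp, bOp_mul_aOp,
      bOp_mul_aDag, bDag_mul_aOp, bDag_mul_aDag, aOp_mul_aDag, aDag_mul_aOp, bOp_mul_bDag,
      bDag_mul_bOp, mul_mul_eq_of_mul_eq (aOp_mul_diagOp q _),
      mul_mul_eq_of_mul_eq (bOp_mul_diagOp q _), mul_mul_eq_of_mul_eq (aDag_mul_diagOp q _),
      mul_mul_eq_of_mul_eq (bDag_mul_diagOp q _), mul_mul_eq_of_mul_eq (bOp_mul_aOp q),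
      mul_mul_eq_of_mul_eq (bOp_mul_aDag q), mul_mul_eq_of_mul_eq (bDag_mul_aOp q),
      mul_mul_eq_of_mul_eq (bDag_mul_aDag q), mul_mul_eq_of_mul_eq (aOp_mul_aDag q),
      mul_mul_eq_of_mul_eq (aDag_mul_aOp q), mul_mul_eq_of_mul_eq (bOp_mul_bDag q),
      mul_mul_eq_of_mul_eq (bDag_mul_bOp q), diagOp_mul, mul_mul_eq_of_mul_eq (diagOp_mul _ _),
      neg_diagOp_mul, ← smul_mul_assoc, smul_diagOp, ← add_mul, diagOp_add] <;>
    congr 2 <;> funext x y <;>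
    have hx := qpow_ne_zero q (x / 4) <;>
    have hy := qpow_ne_zero q (y / 4) <;>
    simp only [sub_div, add_div, neg_sub, qpow_sub, qpow_add, qpow_neg, ofReal_qnum, qpow_half,
      qpow_three_quarters] <;>
    field_simp <;> ring

/-! ### Operators acting on one ribbon -/

theorem leg_mul {N : ℕ} (k : Fin N) (A B : FockOp) : leg k (A * B) = leg k A * leg k B := by
  rw [leg, leg, leg, ← PiTensorProduct.map_mul]
  congr 1
  ext l : 1
  by_cases h : l = k
  · subst h; simp
  · simp [h, Module.End.mul_eq_comp]

theorem leg_one {N : ℕ} (k : Fin N) : leg k 1 = 1 := by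
  rw [leg, ← Module.End.one_eq_id, Function.update_eq_self_iff.2 rfl]
  exact PiTensorProduct.map_one

theorem leg_add {N : ℕ} (k : Fin N) (A B : FockOp) : leg k (A + B) = leg k A + leg k B := by
  refine PiTensorProduct.ext (MultilinearMap.ext fun x => ?_)
  simp only [LinearMap.compMultilinearMap_apply, LinearMap.add_apply, leg_tprod,
    MultilinearMap.map_update_add]

theorem leg_smul {N : ℕ} (k : Fin N) (c : ℂ) (A : FockOp) : leg k (c • A) = c • leg k A := by
  refine PiTensorProduct.ext (MultilinearMap.ext fun x => ?_)
  simp only [LinearMap.compMultilinearMap_apply, LinearMap.smul_apply, leg_tprod,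
    MultilinearMap.map_update_smul]

theorem leg_zero {N : ℕ} (k : Fin N) : leg k 0 = 0 := by
  simpa using leg_smul k 0 0

theorem leg_pow {N : ℕ} (k : Fin N) (A : FockOp) (m : ℕ) : leg k (A ^ m) = leg k A ^ m := by
  induction m with
  | zero => simp [leg_one]
  | succ m ih => rw [pow_succ, pow_succ, leg_mul, ih]

theorem leg_commute {N : ℕ} {i j : Fin N} (h : i ≠ j) (A B : FockOp) :
    Commute (leg i A) (leg j B) := by
  rw [Commute, SemiconjBy, leg, leg, ← PiTensorProduct.map_mul, ← PiTensorProduct.map_mul]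
  congr 1
  ext l : 1
  by_cases hi : l = i
  · subst hi; simp [h, Module.End.mul_eq_comp]
  · by_cases hj : l = j
    · subst hj; simp [hi, Module.End.mul_eq_comp]
    · simp [hi, hj]

theorem leg_mul_leg_mul {N : ℕ} {i j : Fin N} (h : i ≠ j) (A B A' B' : FockOp) :
    leg i A * leg j B * (leg i A' * leg j B') = leg i (A * A') * leg j (B * B') := by
  rw [leg_mul, leg_mul]
  exact Commute.mul_mul_mul_comm (leg_commute h A' B).symm _ _

theorem vertexBasis_apply {N : ℕ} (ν : Fin N → ℕ × ℕ) :
    vertexBasis N ν = PiTensorProduct.tprod ℂ fun k => ket (ν k) := by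
  simp [vertexBasis]

theorem leg_vertexBasis {N : ℕ} (k : Fin N) {A : FockOp} {ν : Fin N → ℕ × ℕ} {c : ℂ} {s : ℕ × ℕ}
    (h : A (ket (ν k)) = c • ket s) :
    leg k A (vertexBasis N ν) = c • vertexBasis N (Function.update ν k s) := by
  rw [vertexBasis_apply, vertexBasis_apply, leg_tprod, h, MultilinearMap.map_update_smul]
  congr 2
  ext l : 1
  by_cases hl : l = k
  · subst hl; simp
  · simp [hl]

/-! ### Weights -/

/-- `A` raises the eigenvalue of `J_z` by `w` and maps occupation number states to multiples of
such states. -/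
def IsWeight (w : ℝ) (A : FockOp) : Prop :=
  ∀ s, ∃ (c : ℂ) (t : ℕ × ℕ), A (ket s) = c • ket t ∧ (c = 0 ∨ magnetic t = magnetic s + w)

theorem IsWeight.of_eq {w w' : ℝ} {A : FockOp} (h : IsWeight w A) (hw : w = w') :
    IsWeight w' A := hw ▸ h

theorem isWeight_one : IsWeight 0 1 := fun s => ⟨1, s, by simp⟩

theorem isWeight_zero (w : ℝ) : IsWeight w 0 := fun s => ⟨0, s, by simp⟩

theorem IsWeight.smul {w : ℝ} {A : FockOp} (h : IsWeight w A) (c : ℂ) : IsWeight w (c • A) := by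
  intro s
  obtain ⟨d, t, h1, h2⟩ := h s
  refine ⟨c * d, t, by rw [LinearMap.smul_apply, h1, smul_smul], h2.imp (fun h => by simp [h]) id⟩

theorem IsWeight.mul {w w' : ℝ} {A B : FockOp} (hA : IsWeight w A) (hB : IsWeight w' B) :
    IsWeight (w' + w) (A * B) := by
  intro s
  obtain ⟨d, t, h1, h2⟩ := hB s
  obtain ⟨e, u, h3, h4⟩ := hA t
  refine ⟨d * e, u, by rw [Module.End.mul_apply, h1, map_smul, h3, smul_smul], ?_⟩
  rcases h2 with h2 | h2
  · simp [h2]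
  · rcases h4 with h4 | h4
    · simp [h4]
    · right; rw [h4, h2]; ring

theorem isWeight_qpowN (q : DeformParam) (f : ℝ → ℝ → ℝ) : IsWeight 0 (qpowN q f) :=
  fun s => ⟨_, s, by rw [qpowN, opOfKet_ket], by simp⟩

theorem isWeight_aOp (q : DeformParam) : IsWeight (-(1 / 2)) (aOp q) := by
  rintro ⟨_ | m, n⟩
  · exact ⟨0, (0, n), by simp [aOp], by simp⟩
  · exact ⟨_, (m, n), by rw [aOp, opOfKet_ket]; rfl, by right; simp [magnetic]; ring⟩

theorem isWeight_bOp (q : DeformParam) : IsWeight (1 / 2) (bOp q) := by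
  rintro ⟨m, _ | n⟩
  · exact ⟨0, (m, 0), by simp [bOp], by simp⟩
  · exact ⟨_, (m, n), by rw [bOp, opOfKet_ket]; rfl, by right; simp [magnetic]; ring⟩

theorem isWeight_aDag (q : DeformParam) : IsWeight (1 / 2) (aDag q) :=
  fun s => ⟨_, (s.1 + 1, s.2), by rw [aDag, opOfKet_ket], by right; simp [magnetic]; ring⟩

theorem isWeight_bDag (q : DeformParam) : IsWeight (-(1 / 2)) (bDag q) :=
  fun s => ⟨_, (s.1, s.2 + 1), by rw [bDag, opOfKet_ket], by right; simp [magnetic]; ring⟩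

theorem isWeight_K (q : DeformParam) : IsWeight 0 (jordanGen q .K) := by
  rw [jordanGen]
  exact isWeight_qpowN q _

theorem isWeight_Kinv (q : DeformParam) : IsWeight 0 (jordanGen q .Kinv) := by
  rw [jordanGen]
  exact isWeight_qpowN q _

theorem isWeight_Jp (q : DeformParam) : IsWeight 1 (jordanGen q .Jp) := by
  rw [jordanGen]
  exact ((isWeight_aDag q).mul (isWeight_bOp q)).of_eq (by norm_num)

theorem isWeight_Jm (q : DeformParam) : IsWeight (-1) (jordanGen q .Jm) := by
  rw [jordanGen]
  exact ((isWeight_aOp q).mul (isWeight_bDag q)).of_eq (by norm_num)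

theorem IsWeight.neg {w : ℝ} {A : FockOp} (h : IsWeight w A) : IsWeight w (-A) := by
  rw [← neg_one_smul ℂ A]
  exact h.smul (-1)

theorem isWeight_tauSpinor_zero (q : DeformParam) (ε : SpinSign) :
    IsWeight (-(1 / 2)) (tauSpinor q ε 0) := by
  cases ε <;> simp only [tauSpinor, Matrix.cons_val_zero]
  · exact ((isWeight_qpowN q _).mul (isWeight_aOp q)).of_eq (by norm_num)
  · exact (((isWeight_bDag q).mul (isWeight_qpowN q _)).of_eq (by norm_num)).neg

theorem isWeight_tauSpinor_one (q : DeformParam) (ε : SpinSign) :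
    IsWeight (1 / 2) (tauSpinor q ε 1) := by
  cases ε <;> simp only [tauSpinor, Matrix.cons_val_one, Matrix.cons_val_fin_one]
  · exact ((isWeight_qpowN q _).mul (isWeight_bOp q)).of_eq (by norm_num)
  · exact ((isWeight_aDag q).mul (isWeight_qpowN q _)).of_eq (by norm_num)

theorem isWeight_tSpinor_zero (q : DeformParam) (ε : SpinSign) :
    IsWeight (-(1 / 2)) (tSpinor q ε 0) := by
  cases ε <;> simp only [tSpinor, Matrix.cons_val_zero]
  · exact ((isWeight_qpowN q _).mul (isWeight_aOp q)).of_eq (by norm_num)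
  · exact (((isWeight_bDag q).mul (isWeight_qpowN q _)).of_eq (by norm_num)).neg

theorem isWeight_tSpinor_one (q : DeformParam) (ε : SpinSign) :
    IsWeight (1 / 2) (tSpinor q ε 1) := by
  cases ε <;> simp only [tSpinor, Matrix.cons_val_one, Matrix.cons_val_fin_one]
  · exact ((isWeight_qpowN q _).mul (isWeight_bOp q)).of_eq (by norm_num)
  · exact ((isWeight_aDag q).mul (isWeight_qpowN q _)).of_eq (by norm_num)

/-- `q^{w J_z}`. -/
def qpowJz (q : DeformParam) (w : ℝ) : FockOp := qpowN q fun x y => w * ((x - y) / 2)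

theorem qpowJz_ket (q : DeformParam) (w : ℝ) (s : ℕ × ℕ) :
    qpowJz q w (ket s) = qpow q (w * magnetic s) • ket s := by
  simp only [qpowJz, qpowN, opOfKet_ket, magnetic]

theorem isWeight_qpowJz (q : DeformParam) (v : ℝ) : IsWeight 0 (qpowJz q v) :=
  isWeight_qpowN q _

theorem qpowJz_zero (q : DeformParam) : qpowJz q 0 = 1 := by
  refine op_ext fun s => ?_
  rw [qpowJz_ket, zero_mul, qpow_zero, one_smul, Module.End.one_apply]

theorem qpowJz_mul (q : DeformParam) (w w' : ℝ) :
    qpowJz q w * qpowJz q w' = qpowJz q (w + w') := by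
  refine op_ext fun s => ?_
  rw [Module.End.mul_apply, qpowJz_ket, map_smul, qpowJz_ket, qpowJz_ket, smul_smul, ← qpow_add]
  congr 2
  ring

theorem jordanGen_K (q : DeformParam) : jordanGen q .K = qpowJz q (1 / 2) := by
  refine op_ext fun s => ?_
  rw [jordan_K, qpowJz_ket, magnetic]
  congr 2
  ring

theorem jordanGen_Kinv (q : DeformParam) : jordanGen q .Kinv = qpowJz q (-(1 / 2)) := by
  refine op_ext fun s => ?_
  rw [jordan_Kinv, qpowJz_ket, magnetic]
  congr 2
  ring

theorem IsWeight.qpowJz_mul {q : DeformParam} {w : ℝ} {A : FockOp} (h : IsWeight w A) (v : ℝ) :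
    qpowJz q v * A = qpow q (v * w) • (A * qpowJz q v) := by
  refine op_ext fun s => ?_
  obtain ⟨c, t, h1, h2⟩ := h s
  rw [LinearMap.smul_apply, Module.End.mul_apply, Module.End.mul_apply, qpowJz_ket, map_smul, h1,
    map_smul, qpowJz_ket]
  rcases h2 with rfl | h2
  · simp
  · rw [h2, mul_add, qpow_add]
    simp only [smul_smul]
    congr 1
    ring

/-! ### The diagonal factor of the `R`-matrix -/

theorem qJzJz_vertexBasis (q : DeformParam) {N : ℕ} (i j : Fin N) (ν : Fin N → ℕ × ℕ) :
    qJzJz q i j (vertexBasis N ν) =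
      qpow q (magnetic (ν i) * magnetic (ν j)) • vertexBasis N ν := by
  rw [qJzJz, Module.Basis.constr_basis]

theorem isUnit_qJzJz (q : DeformParam) {N : ℕ} (i j : Fin N) : IsUnit (qJzJz q i j) := by
  set B : Module.End ℂ (Vertex N) := (vertexBasis N).constr ℂ fun ν =>
    qpow q (-(magnetic (ν i) * magnetic (ν j))) • vertexBasis N ν with hB
  have hBν : ∀ ν, B (vertexBasis N ν) =
      qpow q (-(magnetic (ν i) * magnetic (ν j))) • vertexBasis N ν := fun ν => by
    rw [hB, Module.Basis.constr_basis]
  refine ⟨⟨qJzJz q i j, B, ?_, ?_⟩, rfl⟩ <;> refine (vertexBasis N).ext fun ν => ?_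
  · rw [Module.End.mul_apply, hBν, map_smul, qJzJz_vertexBasis, smul_smul, ← qpow_add,
      neg_add_cancel, qpow_zero, one_smul, Module.End.one_apply]
  · rw [Module.End.mul_apply, qJzJz_vertexBasis, map_smul, hBν, smul_smul, ← qpow_add,
      add_neg_cancel, qpow_zero, one_smul, Module.End.one_apply]

/-- From `(m + w)(m' + w') = m m' + w' m + w m' + w w'`: the cross terms become powers of `q^{J_z}`
on the two ribbons, and `w w'` becomes the scalar. -/
theorem qJzJz_mul_leg_mul_leg (q : DeformParam) {N : ℕ} {i j : Fin N} (hij : i ≠ j) {w w' : ℝ}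
    {A B : FockOp} (hA : IsWeight w A) (hB : IsWeight w' B) :
    qJzJz q i j * (leg i A * leg j B) =
      qpow q (w * w') • (leg i (A * qpowJz q w') * leg j (B * qpowJz q w)) * qJzJz q i j := by
  refine (vertexBasis N).ext fun ν => ?_
  obtain ⟨c, s, hs, hs'⟩ := hA (ν i)
  obtain ⟨d, t, ht, ht'⟩ := hB (ν j)
  have hA' : (A * qpowJz q w') (ket (ν i)) = (qpow q (w' * magnetic (ν i)) * c) • ket s := by
    rw [Module.End.mul_apply, qpowJz_ket, map_smul, hs, smul_smul]
  have hB' : (B * qpowJz q w) (ket (ν j)) = (qpow q (w * magnetic (ν j)) * d) • ket t := by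
    rw [Module.End.mul_apply, qpowJz_ket, map_smul, ht, smul_smul]
  simp only [Module.End.mul_apply, LinearMap.smul_apply, qJzJz_vertexBasis, map_smul]
  rw [leg_vertexBasis j ht, leg_vertexBasis j hB', map_smul, map_smul, map_smul,
    leg_vertexBasis i (s := s) (c := c) (by simpa [hij] using hs),
    leg_vertexBasis i (s := s) (c := qpow q (w' * magnetic (ν i)) * c) (by simpa [hij] using hA'),
    map_smul, qJzJz_vertexBasis]
  simp only [smul_smul, Function.update_self, Function.update_of_ne hij.symm]
  congr 1
  -- If a matrix element vanishes, both sides are zero; otherwise the weights of `s` and `t` are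
  -- known.
  rcases hs' with rfl | hs'
  · simp
  rcases ht' with rfl | ht'
  · simp
  rw [hs', ht', show (magnetic (ν i) + w) * (magnetic (ν j) + w') = w * w' +
    w' * magnetic (ν i) + w * magnetic (ν j) + magnetic (ν i) * magnetic (ν j) by ring]
  simp only [qpow_add]
  ring

theorem qJzJz_commute_leg (q : DeformParam) {N : ℕ} {i j l : Fin N} (hi : i ≠ l) (hj : j ≠ l)
    {w : ℝ} {A : FockOp} (hA : IsWeight w A) : Commute (qJzJz q i j) (leg l A) := by
  refine (vertexBasis N).ext fun ν => ?_
  obtain ⟨c, s, hs, -⟩ := hA (ν l)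
  rw [Module.End.mul_apply, Module.End.mul_apply, leg_vertexBasis l hs, qJzJz_vertexBasis,
    map_smul, map_smul, leg_vertexBasis l hs, qJzJz_vertexBasis, Function.update_of_ne hi,
    Function.update_of_ne hj, smul_comm]

/-! ### The series in the `R`-matrix -/

theorem qnum_ne_zero (q : DeformParam) {x : ℝ} (hx : x ≠ 0) : qnum q x ≠ 0 := by
  refine div_ne_zero (fun h => hx ?_) (qnum_den_sq_pos q)
  have := (Real.rpow_right_inj q.2.1 q.2.2).1 (sub_eq_zero.1 h)
  linarith

/-- The coefficients `(1 - q⁻¹)^m / [m]! q^{m(m-1)/4}` of the `R`-matrix. -/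
def rCoeff (q : DeformParam) (m : ℕ) : ℂ :=
  ((1 - q.1⁻¹) ^ m / qfactorial q m : ℝ) * qpow q ((m : ℝ) * ((m : ℝ) - 1) / 4)

theorem rCoeff_zero (q : DeformParam) : rCoeff q 0 = 1 := by
  simp [rCoeff, qfactorial, qpow_zero]

theorem qpow_neg_one (q : DeformParam) : qpow q (-1) = ((q.1⁻¹ : ℝ) : ℂ) := by
  rw [qpow, Real.rpow_neg_one]

theorem one_sub_inv_ne_zero (q : DeformParam) : 1 - q.1⁻¹ ≠ 0 := by
  rw [sub_ne_zero]
  intro h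
  exact q.2.2 (inv_eq_one.1 h.symm)

theorem rCoeff_ne_zero (q : DeformParam) (m : ℕ) : rCoeff q m ≠ 0 := by
  refine mul_ne_zero (Complex.ofReal_ne_zero.2 (div_ne_zero
    (pow_ne_zero _ (one_sub_inv_ne_zero q)) (Finset.prod_ne_zero_iff.2 fun k _ => ?_)))
    (qpow_ne_zero q _)
  exact qnum_ne_zero q (by positivity)

/-- Links the symmetric `q`-numbers of the `R`-matrix with the geometric sums in `p = q⁻¹` that come
from normal ordering. -/
theorem ofReal_qnum_succ (q : DeformParam) (m : ℕ) : (qnum q ((m : ℝ) + 1) : ℂ) =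
    qpow q ((m : ℝ) / 2) * ∑ i ∈ Finset.range (m + 1), qpow q (-1) ^ i := by
  have h1 : (1 - qpow q (-1)) ≠ 0 := by
    rw [qpow_neg_one]
    exact_mod_cast one_sub_inv_ne_zero q
  have h2 := mul_neg_geom_sum (qpow q (-1)) (m + 1)
  have h3 : (qpow q (1 / 2) - qpow q (-(1 / 2))) = qpow q (1 / 2) * (1 - qpow q (-1)) := by
    rw [mul_sub, mul_one, ← qpow_add]
    norm_num
  have h4 : (qnum q ((m : ℝ) + 1) : ℂ) = (qpow q (((m : ℝ) + 1) / 2) -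
      qpow q (-(((m : ℝ) + 1) / 2))) / (qpow q (1 / 2) - qpow q (-(1 / 2))) := by
    simp [qnum, qpow]
  rw [h4, h3, div_eq_iff (mul_ne_zero (qpow_ne_zero q _) h1)]
  have h5 : qpow q (((m : ℝ) + 1) / 2) = qpow q ((m : ℝ) / 2) * qpow q (1 / 2) := by
    rw [← qpow_add]; congr 1; ring
  have h6 : qpow q (-(((m : ℝ) + 1) / 2)) =
      qpow q ((m : ℝ) / 2) * qpow q (1 / 2) * qpow q (-1) ^ (m + 1) := by
    rw [← qpow_nat_mul, ← qpow_add, ← qpow_add]; congr 1; push_cast; ring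
  rw [h5, h6]
  linear_combination (-qpow q ((m : ℝ) / 2) * qpow q (1 / 2)) * h2

theorem rCoeff_succ_mul (q : DeformParam) (m : ℕ) :
    rCoeff q (m + 1) * ∑ i ∈ Finset.range (m + 1), qpow q (-1) ^ i =
      (1 - qpow q (-1)) * rCoeff q m := by
  have h1 : (qnum q ((m : ℝ) + 1) : ℂ) ≠ 0 :=
    Complex.ofReal_ne_zero.2 (qnum_ne_zero q (by positivity))
  have h2 : qfactorial q (m + 1) = qfactorial q m * qnum q ((m : ℝ) + 1) :=
    Finset.prod_range_succ _ _
  have h3 : (qfactorial q m : ℂ) ≠ 0 :=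
    Complex.ofReal_ne_zero.2 (Finset.prod_ne_zero_iff.2 fun k _ => qnum_ne_zero q (by positivity))
  -- The quadratic exponent grows by `m / 2`, which cancels the prefactor `q^{m/2}` of `[m + 1]`.
  have h4 : qpow q (((m + 1 : ℕ) : ℝ) * (((m + 1 : ℕ) : ℝ) - 1) / 4) =
      qpow q ((m : ℝ) * ((m : ℝ) - 1) / 4) * qpow q ((m : ℝ) / 2) := by
    rw [← qpow_add]; congr 1; push_cast; ring
  have h5 := ofReal_qnum_succ q m
  rw [rCoeff, rCoeff, h2, h4, qpow_neg_one] at *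
  push_cast at *
  rw [div_mul_eq_mul_div, div_mul_eq_mul_div, div_mul_eq_mul_div, mul_div_assoc',
    div_eq_div_iff (mul_ne_zero h3 h1) h3, h5]
  ring

/-- The sum in the `R`-matrix. -/
def rSeries (q : DeformParam) {N : ℕ} (i j : Fin N) : Module.End ℂ (Vertex N) :=
  (vertexBasis N).constr ℂ fun ν => ∑ᶠ n : ℕ, rTerm q i j n (vertexBasis N ν)

theorem rMatrix_eq (q : DeformParam) {N : ℕ} (i j : Fin N) :
    rMatrix q i j = qJzJz q i j * rSeries q i j := rfl

/-- The operator `K J_+ ⊗ K⁻¹ J_-`. -/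
def rNilp (q : DeformParam) {N : ℕ} (i j : Fin N) : Module.End ℂ (Vertex N) :=
  leg i (jordanGen q .K * jordanGen q .Jp) * leg j (jordanGen q .Kinv * jordanGen q .Jm)

theorem rTerm_eq (q : DeformParam) {N : ℕ} {i j : Fin N} (hij : i ≠ j) (n : ℕ) :
    rTerm q i j n = rCoeff q n • rNilp q i j ^ n := by
  rw [rTerm, rNilp, (leg_commute hij _ _).mul_pow, ← leg_pow, ← leg_pow]
  simp only [map_pow, map_mul, jordan_gen]
  rfl

theorem isLocalSeries_rSeries (q : DeformParam) {N : ℕ} {i j : Fin N} (hij : i ≠ j) :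
    IsLocalSeries (rCoeff q) (rNilp q i j) (rSeries q i j) where
  nilpotent v := by
    -- Some term of the series vanishes on `v`; its coefficient is nonzero, so `X ^ M` kills `v`.
    obtain ⟨M, hM⟩ := (rTerm_finite q hij v).infinite_compl.nonempty
    refine ⟨M, ?_⟩
    simpa [rTerm_eq q hij, rCoeff_ne_zero] using hM
  apply_eq v M hM := by
    -- The series is defined on the basis only. Its value on an arbitrary vector follows from that
    -- of `R` by cancelling the injective diagonal factor.
    have h := rMatrix_apply q hij v
    rw [rMatrix_eq, Module.End.mul_apply] at h
    rw [((Module.End.isUnit_iff _).1 (isUnit_qJzJz q i j)).1 h]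
    simp only [rTerm_eq q hij, LinearMap.smul_apply]
    refine finsum_eq_sum_of_support_subset _ fun n hn => ?_
    by_contra hnM
    simp only [Finset.coe_range, Set.mem_Iio, not_lt] at hnM
    exact hn (by simp [pow_apply_eq_zero_of_le hnM hM])

theorem isUnit_rMatrix (q : DeformParam) {N : ℕ} {i j : Fin N} (hij : i ≠ j) :
    IsUnit (rMatrix q i j) :=
  (isUnit_qJzJz q i j).mul ((isLocalSeries_rSeries q hij).isUnit (rCoeff_zero q))

theorem rMatrix_commute_leg (q : DeformParam) {N : ℕ} {i j l : Fin N} (hij : i ≠ j) (hi : i ≠ l)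
    (hj : j ≠ l) {w : ℝ} {A : FockOp} (hA : IsWeight w A) :
    Commute (rMatrix q i j) (leg l A) :=
  (qJzJz_commute_leg q hi hj hA).mul_left ((isLocalSeries_rSeries q hij).commute
    ((leg_commute hi.symm _ _).mul_right (leg_commute hj.symm _ _))).symm

/-! ### Braiding of two ribbons -/

theorem leg_mul_leg_smul {N : ℕ} (i j : Fin N) (c d : ℂ) (A B : FockOp) :
    leg i (c • A) * leg j (d • B) = (c * d) • (leg i A * leg j B) := by
  rw [leg_smul, leg_smul, smul_mul_smul_comm]

theorem isWeight_KJp (q : DeformParam) : IsWeight 1 (jordanGen q .K * jordanGen q .Jp) :=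
  ((isWeight_K q).mul (isWeight_Jp q)).of_eq (by norm_num)

theorem isWeight_KinvJm (q : DeformParam) : IsWeight (-1) (jordanGen q .Kinv * jordanGen q .Jm) :=
  ((isWeight_Kinv q).mul (isWeight_Jm q)).of_eq (by norm_num)

theorem KJp_mul_Kinv (q : DeformParam) :
    jordanGen q .K * jordanGen q .Jp * jordanGen q .Kinv = qpow q (1 / 2) • jordanGen q .Jp := by
  rw [jordanGen_K, (isWeight_Jp q).qpowJz_mul, smul_mul_assoc, mul_assoc, jordanGen_Kinv,
    qpowJz_mul, add_neg_cancel, qpowJz_zero, mul_one, mul_one]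

theorem KinvJm_mul_K (q : DeformParam) :
    jordanGen q .Kinv * jordanGen q .Jm * jordanGen q .K = qpow q (1 / 2) • jordanGen q .Jm := by
  rw [jordanGen_Kinv, (isWeight_Jm q).qpowJz_mul, smul_mul_assoc, mul_assoc, jordanGen_K,
    qpowJz_mul, neg_add_cancel, qpowJz_zero, mul_one, mul_neg_one, neg_neg]

theorem Jp_mul_KJp (q : DeformParam) :
    jordanGen q .Jp * (jordanGen q .K * jordanGen q .Jp) =
      qpow q (-(1 / 2)) • (jordanGen q .K * jordanGen q .Jp * jordanGen q .Jp) := by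
  rw [jordanGen_K, (isWeight_Jp q).qpowJz_mul, smul_mul_assoc, mul_assoc,
    (isWeight_Jp q).qpowJz_mul, mul_smul_comm, smul_smul, smul_smul, ← qpow_add, ← qpow_add]
  norm_num

theorem Jm_mul_KinvJm (q : DeformParam) :
    jordanGen q .Jm * (jordanGen q .Kinv * jordanGen q .Jm) =
      qpow q (-(1 / 2)) • (jordanGen q .Kinv * jordanGen q .Jm * jordanGen q .Jm) := by
  rw [jordanGen_Kinv, (isWeight_Jm q).qpowJz_mul, smul_mul_assoc, mul_assoc,
    (isWeight_Jm q).qpowJz_mul, mul_smul_comm, smul_smul, smul_smul, ← qpow_add, ← qpow_add]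
  norm_num

/-- Writes the coefficient as `γ κ` with `γ = q^{1/4}`, the form in which the braiding produces it.
For `S(L̃)` below, `γ = -q^{3/4}`. -/
theorem fluxCoeff_eq (q : DeformParam) :
    qpow q (-(1 / 4)) * (qpow q (1 / 2) - qpow q (-(1 / 2))) =
      qpow q (1 / 4) * (1 - qpow q (-1)) := by
  rw [mul_sub, mul_sub, ← qpow_add, ← qpow_add, ← qpow_add, mul_one]
  norm_num

theorem antipodeFluxCoeff_eq (q : DeformParam) :
    -(qpow q (1 / 4) * (qpow q (1 / 2) - qpow q (-(1 / 2)))) =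
      -qpow q (3 / 4) * (1 - qpow q (-1)) := by
  rw [neg_mul, mul_sub, mul_sub, ← qpow_add, ← qpow_add, ← qpow_add, mul_one]
  norm_num

theorem conj_qpow (q : DeformParam) (x : ℝ) : (starRingEnd ℂ) (qpow q x) = qpow q x :=
  Complex.conj_ofReal _

theorem isAdjoint_Jp_smul (q : DeformParam) {c : ℂ} (hc : (starRingEnd ℂ) c = c) :
    dagger (c • jordanGen q .Jp) = c • jordanGen q .Jm := by
  have h := dagger_eq ((isAdjoint_Jp q).smul c)
  rwa [hc] at h

theorem matDagger_fluxOp (q : DeformParam) : matDagger (fluxOp q) =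
    !![jordanGen q .K,
      (qpow q (-(1 / 4)) * (qpow q (1 / 2) - qpow q (-(1 / 2)))) • jordanGen q .Jm;
      0, jordanGen q .Kinv] := by
  have h := isAdjoint_Jp_smul q
    (c := qpow q (-(1 / 4)) * (qpow q (1 / 2) - qpow q (-(1 / 2)))) (by simp [conj_qpow])
  rw [fluxOp_eq]
  refine Matrix.ext fun i j => ?_
  fin_cases i <;> fin_cases j
  · simpa [matDagger] using dagger_eq (isAdjoint_K q)
  · simpa [matDagger] using h
  · simpa [matDagger] using dagger_eq isAdjoint_zero
  · simpa [matDagger] using dagger_eq (isAdjoint_Kinv q)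

theorem matDagger_antipodeFluxOp (q : DeformParam) : matDagger (antipodeFluxOp q) =
    !![jordanGen q .Kinv,
      (-(qpow q (1 / 4) * (qpow q (1 / 2) - qpow q (-(1 / 2))))) • jordanGen q .Jm;
      0, jordanGen q .K] := by
  have h := isAdjoint_Jp_smul q
    (c := -(qpow q (1 / 4) * (qpow q (1 / 2) - qpow q (-(1 / 2))))) (by simp [conj_qpow])
  rw [antipodeFluxOp_eq]
  refine Matrix.ext fun i j => ?_
  fin_cases i <;> fin_cases j
  · simpa [matDagger] using dagger_eq (isAdjoint_Kinv q)
  · exact h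
  · simpa [matDagger] using dagger_eq isAdjoint_zero
  · simpa [matDagger] using dagger_eq (isAdjoint_K q)

theorem rSeries_mul_eq (q : DeformParam) {N : ℕ} {i j : Fin N} (hij : i ≠ j)
    {γ : ℂ} {P Q : Module.End ℂ (Vertex N)}
    (hP : P * rNilp q i j = rNilp q i j * P + γ • Q)
    (hQ : Q * rNilp q i j = qpow q (-1) • (rNilp q i j * Q)) :
    P * rSeries q i j = rSeries q i j * (P + (γ * (1 - qpow q (-1))) • Q) :=
  (isLocalSeries_rSeries q hij).mul_eq (rCoeff_succ_mul q) hP hQ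

theorem rSeries_eq_mul (q : DeformParam) {N : ℕ} {i j : Fin N} (hij : i ≠ j)
    {γ : ℂ} {P Q : Module.End ℂ (Vertex N)}
    (hP : rNilp q i j * P = P * rNilp q i j + γ • Q)
    (hQ : rNilp q i j * Q = qpow q (-1) • (Q * rNilp q i j)) :
    rSeries q i j * P = (P + (γ * (1 - qpow q (-1))) • Q) * rSeries q i j :=
  (isLocalSeries_rSeries q hij).eq_mul (rCoeff_succ_mul q) hP hQ

/-- Moving `q^{J_z ⊗ J_z}` past an operator on the second ribbon. -/
theorem leg_right_mul_qJzJz (q : DeformParam) {N : ℕ} {i j : Fin N} (hij : i ≠ j)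
    {w : ℝ} {B : FockOp} (hB : IsWeight w B) :
    leg j B * qJzJz q i j = qJzJz q i j * (leg i (qpowJz q (-w)) * leg j B) := by
  -- The factor `q^{-w J_z}` is chosen to cancel the `q^{w J_z}` created by the weight of `B`.
  have h := qJzJz_mul_leg_mul_leg q hij (isWeight_qpowJz q (-w)) hB
  rw [h, qpowJz_mul, neg_add_cancel, qpowJz_zero, mul_one, zero_mul, qpow_zero, one_smul, leg_one,
    one_mul]

theorem leg_left_mul_qJzJz (q : DeformParam) {N : ℕ} {i j : Fin N} (hij : i ≠ j)
    {w : ℝ} {A : FockOp} (hA : IsWeight w A) :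
    leg i A * qJzJz q i j = qJzJz q i j * (leg i A * leg j (qpowJz q (-w))) := by
  have h := qJzJz_mul_leg_mul_leg q hij hA (isWeight_qpowJz q (-w))
  rw [h, qpowJz_mul, neg_add_cancel, qpowJz_zero, mul_one, mul_zero, qpow_zero, one_smul, leg_one,
    mul_one]

theorem qJzJz_mul_leg_right (q : DeformParam) {N : ℕ} {i j : Fin N} (hij : i ≠ j)
    {w : ℝ} {B : FockOp} (hB : IsWeight w B) :
    qJzJz q i j * leg j B = leg i (qpowJz q w) * leg j B * qJzJz q i j := by
  have h := qJzJz_mul_leg_mul_leg q hij isWeight_one hB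
  rwa [qpowJz_zero, mul_one, zero_mul, qpow_zero, one_smul, leg_one, one_mul, one_mul] at h

theorem qJzJz_mul_leg_left (q : DeformParam) {N : ℕ} {i j : Fin N} (hij : i ≠ j)
    {w : ℝ} {A : FockOp} (hA : IsWeight w A) :
    qJzJz q i j * leg i A = leg i A * leg j (qpowJz q w) * qJzJz q i j := by
  have h := qJzJz_mul_leg_mul_leg q hij hA isWeight_one
  rwa [qpowJz_zero, mul_one, mul_zero, qpow_zero, one_smul, leg_one, one_mul, mul_one] at h

/-- The diagonal factor contributes `q^{J_z/2} = K`, as `τ̃_-` has weight `-1/2`. The factors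
`q^{1/2}` from `K` and `q^{-1/2}` from `τ̃_-` cancel, so `K ⊗ τ̃_-` commutes with `X`. -/
theorem tau_zero_mul_rMatrix (q : DeformParam) {N : ℕ} {i j : Fin N} (hij : i ≠ j)
    (ε : SpinSign) :
    leg j (tauSpinor q ε 0) * rMatrix q i j =
    rMatrix q i j * (leg i (jordanGen q .K) * leg j (tauSpinor q ε 0)) := by
  have h : Commute (leg i (jordanGen q .K) * leg j (tauSpinor q ε 0)) (rNilp q i j) := by
    rw [Commute, SemiconjBy, rNilp, leg_mul_leg_mul hij, leg_mul_leg_mul hij,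
      (tauSpinor_relations q ε).1]
    nth_rw 1 [jordanGen_K]
    rw [(isWeight_KJp q).qpowJz_mul, leg_mul_leg_smul, ← qpow_add, jordanGen_K]
    norm_num [qpow_zero]
  rw [rMatrix_eq, ← mul_assoc, leg_right_mul_qJzJz q hij (isWeight_tauSpinor_zero q ε), neg_neg,
    ← jordanGen_K, mul_assoc, ((isLocalSeries_rSeries q hij).commute h).eq, mul_assoc]

/-- The resummation applies with `P = K⁻¹ ⊗ τ̃_+`, `Q = J_+ ⊗ τ̃_-` and `γ = q^{1/4}`; the two
factors of `Q` each give `q^{-1/2}`, hence `p = q⁻¹`. -/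
theorem tau_one_mul_rMatrix (q : DeformParam) {N : ℕ} {i j : Fin N} (hij : i ≠ j)
    (ε : SpinSign) :
    leg j (tauSpinor q ε 1) * rMatrix q i j =
    rMatrix q i j * (leg i (jordanGen q .Kinv) * leg j (tauSpinor q ε 1) +
      (qpow q (1 / 4) * (1 - qpow q (-1))) •
        (leg i (jordanGen q .Jp) * leg j (tauSpinor q ε 0))) := by
  rw [rMatrix_eq, ← mul_assoc, leg_right_mul_qJzJz q hij (isWeight_tauSpinor_one q ε),
    ← jordanGen_Kinv, mul_assoc (qJzJz q i j),
    mul_assoc (qJzJz q i j)]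
  refine congrArg (qJzJz q i j * ·) (rSeries_mul_eq q hij ?_ ?_)
  · have h1 : jordanGen q .Kinv * (jordanGen q .K * jordanGen q .Jp) =
        qpow q (-(1 / 2)) • (jordanGen q .K * jordanGen q .Jp * jordanGen q .Kinv) := by
      rw [jordanGen_Kinv, (isWeight_KJp q).qpowJz_mul, mul_one]
    rw [rNilp, leg_mul_leg_mul hij, leg_mul_leg_mul hij, (tauSpinor_relations q ε).2.1, h1,
      leg_add, mul_add, leg_mul_leg_smul, leg_mul_leg_smul, KJp_mul_Kinv, leg_smul]
    simp only [smul_mul_assoc, smul_smul, ← qpow_add]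
    norm_num
  · rw [rNilp, leg_mul_leg_mul hij, leg_mul_leg_mul hij, (tauSpinor_relations q ε).1, Jp_mul_KJp,
      leg_mul_leg_smul, ← qpow_add]
    norm_num

theorem rMatrix_mul_tau_one (q : DeformParam) {N : ℕ} {i j : Fin N} (hij : i ≠ j)
    (ε : SpinSign) :
    rMatrix q i j * leg i (tauSpinor q ε 1) =
    leg i (tauSpinor q ε 1) * leg j (jordanGen q .K) * rMatrix q i j := by
  have h : Commute (leg i (tauSpinor q ε 1)) (rNilp q i j) := by
    refine Commute.mul_right ?_ (leg_commute hij _ _)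
    rw [Commute, SemiconjBy, ← leg_mul, ← leg_mul, (tauSpinor_relations q ε).2.2.1]
  rw [rMatrix_eq, mul_assoc, ← ((isLocalSeries_rSeries q hij).commute h).eq, ← mul_assoc,
    qJzJz_mul_leg_left q hij (isWeight_tauSpinor_one q ε), ← jordanGen_K, mul_assoc]

/-- Here the series is crossed first, with correction `τ̃_+ K² ⊗ K⁻¹ J_-`. Crossing the diagonal
factor then gives `q^{-J_z}` on `i` and `K` on `j`, which remove `K²` and `K⁻¹` (`hD`). -/
theorem rMatrix_mul_tau_zero (q : DeformParam) {N : ℕ} {i j : Fin N} (hij : i ≠ j)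
    (ε : SpinSign) :
    rMatrix q i j * leg i (tauSpinor q ε 0) =
    (leg i (tauSpinor q ε 0) * leg j (jordanGen q .Kinv) +
      (-qpow q (3 / 4) * (1 - qpow q (-1))) •
        (leg i (tauSpinor q ε 1) * leg j (jordanGen q .Jm))) * rMatrix q i j := by
  have hK : jordanGen q .K * jordanGen q .K = qpowJz q 1 := by
    rw [jordanGen_K, qpowJz_mul]; norm_num
  have hU : rSeries q i j * leg i (tauSpinor q ε 0) = (leg i (tauSpinor q ε 0) +
      (-qpow q (3 / 4) * (1 - qpow q (-1))) •
        (leg i (tauSpinor q ε 1 * qpowJz q 1) * leg j (jordanGen q .Kinv * jordanGen q .Jm))) *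
      rSeries q i j := by
    apply rSeries_eq_mul q hij
    · rw [rNilp, mul_assoc, ← (leg_commute hij (tauSpinor q ε 0) _).eq, ← mul_assoc, ← leg_mul,
        (tauSpinor_relations q ε).2.2.2, leg_add, add_mul, leg_smul, smul_mul_assoc, leg_mul,
        mul_assoc, hK]
    · rw [rNilp, leg_mul_leg_mul hij, leg_mul_leg_mul hij, mul_assoc (tauSpinor q ε 1),
        (isWeight_KJp q).qpowJz_mul, mul_smul_comm, ← mul_assoc, ← mul_assoc,
        ← (tauSpinor_relations q ε).2.2.1, leg_smul, smul_mul_assoc, smul_smul, ← qpow_add]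
      norm_num [qpow_zero, mul_assoc]
  have hD : qJzJz q i j *
      (leg i (tauSpinor q ε 1 * qpowJz q 1) * leg j (jordanGen q .Kinv * jordanGen q .Jm)) =
      leg i (tauSpinor q ε 1) * leg j (jordanGen q .Jm) * qJzJz q i j := by
    rw [qJzJz_mul_leg_mul_leg q hij
      (((isWeight_tauSpinor_one q ε).mul (isWeight_qpowJz q 1)).of_eq
        (zero_add _)) (isWeight_KinvJm q), mul_assoc (tauSpinor q ε 1), qpowJz_mul,
      add_neg_cancel, qpowJz_zero, mul_one, ← jordanGen_K, KinvJm_mul_K, leg_smul, mul_smul_comm,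
      smul_smul, ← qpow_add]
    norm_num [qpow_zero]
  rw [rMatrix_eq, mul_assoc, hU, ← mul_assoc, mul_add,
    qJzJz_mul_leg_left q hij (isWeight_tauSpinor_zero q ε), mul_smul_comm, hD, ← jordanGen_Kinv,
    ← smul_mul_assoc, ← add_mul, mul_assoc]

theorem rMatrix_mul_t_zero (q : DeformParam) {N : ℕ} {i j : Fin N} (hij : i ≠ j)
    (ε : SpinSign) :
    rMatrix q i j * leg j (tSpinor q ε 0) =
    leg i (jordanGen q .Kinv) * leg j (tSpinor q ε 0) * rMatrix q i j := by
  have h : Commute (leg j (tSpinor q ε 0)) (rNilp q i j) := by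
    refine Commute.mul_right (leg_commute hij.symm _ _) ?_
    rw [Commute, SemiconjBy, ← leg_mul, ← leg_mul, (tSpinor_relations q ε).1]
  rw [rMatrix_eq, mul_assoc, ← ((isLocalSeries_rSeries q hij).commute h).eq, ← mul_assoc,
    qJzJz_mul_leg_right q hij (isWeight_tSpinor_zero q ε), ← jordanGen_Kinv, mul_assoc]

/-- As in `rMatrix_mul_tau_zero`, with correction `K J_+ ⊗ t̃_- K⁻²`: the diagonal factor gives
`K⁻¹` on `i` and `q^{J_z}` on `j`, leaving `J_+ ⊗ t̃_-`. -/
theorem rMatrix_mul_t_one (q : DeformParam) {N : ℕ} {i j : Fin N} (hij : i ≠ j)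
    (ε : SpinSign) :
    rMatrix q i j * leg j (tSpinor q ε 1) =
    (leg i (jordanGen q .K) * leg j (tSpinor q ε 1) +
      (-qpow q (3 / 4) * (1 - qpow q (-1))) •
        (leg i (jordanGen q .Jp) * leg j (tSpinor q ε 0))) * rMatrix q i j := by
  have hK : jordanGen q .Kinv * jordanGen q .Kinv = qpowJz q (-1) := by
    rw [jordanGen_Kinv, qpowJz_mul]; norm_num
  have hU : rSeries q i j * leg j (tSpinor q ε 1) = (leg j (tSpinor q ε 1) +
      (-qpow q (3 / 4) * (1 - qpow q (-1))) •
        (leg i (jordanGen q .K * jordanGen q .Jp) * leg j (tSpinor q ε 0 * qpowJz q (-1)))) *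
      rSeries q i j := by
    apply rSeries_eq_mul q hij
    · rw [rNilp, mul_assoc, ← leg_mul, (tSpinor_relations q ε).2.1, leg_add, mul_add, leg_smul,
        mul_smul_comm, leg_mul j (tSpinor q ε 1), ← mul_assoc (leg i _),
        (leg_commute hij _ (tSpinor q ε 1)).eq, mul_assoc, hK]
    · rw [rNilp, leg_mul_leg_mul hij, leg_mul_leg_mul hij, mul_assoc (tSpinor q ε 0),
        (isWeight_KinvJm q).qpowJz_mul, mul_smul_comm, ← mul_assoc, ← mul_assoc (tSpinor q ε 0),
        (tSpinor_relations q ε).1, leg_smul, mul_smul_comm, smul_smul, ← qpow_add]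
      norm_num [qpow_zero, mul_assoc]
  have hD : qJzJz q i j *
      (leg i (jordanGen q .K * jordanGen q .Jp) * leg j (tSpinor q ε 0 * qpowJz q (-1))) =
      leg i (jordanGen q .Jp) * leg j (tSpinor q ε 0) * qJzJz q i j := by
    rw [qJzJz_mul_leg_mul_leg q hij (isWeight_KJp q)
      (((isWeight_tSpinor_zero q ε).mul (isWeight_qpowJz q (-1))).of_eq
        (zero_add _)), mul_assoc (tSpinor q ε 0), qpowJz_mul,
      neg_add_cancel, qpowJz_zero, mul_one, ← jordanGen_Kinv, KJp_mul_Kinv, leg_smul,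
      smul_mul_assoc, smul_mul_assoc, smul_mul_assoc, smul_smul, ← qpow_add]
    norm_num [qpow_zero]
  rw [rMatrix_eq, mul_assoc, hU, ← mul_assoc, mul_add,
    qJzJz_mul_leg_right q hij (isWeight_tSpinor_one q ε), mul_smul_comm, hD, ← jordanGen_K,
    ← smul_mul_assoc, ← add_mul, mul_assoc]

theorem t_one_mul_rMatrix (q : DeformParam) {N : ℕ} {i j : Fin N} (hij : i ≠ j)
    (ε : SpinSign) :
    leg i (tSpinor q ε 1) * rMatrix q i j =
    rMatrix q i j * (leg i (tSpinor q ε 1) * leg j (jordanGen q .Kinv)) := by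
  have h : Commute (leg i (tSpinor q ε 1) * leg j (jordanGen q .Kinv)) (rNilp q i j) := by
    rw [Commute, SemiconjBy, rNilp, leg_mul_leg_mul hij, leg_mul_leg_mul hij,
      (tSpinor_relations q ε).2.2.1]
    nth_rw 1 [jordanGen_Kinv]
    rw [(isWeight_KinvJm q).qpowJz_mul, leg_mul_leg_smul, ← qpow_add, jordanGen_Kinv]
    norm_num [qpow_zero]
  rw [rMatrix_eq, ← mul_assoc, leg_left_mul_qJzJz q hij (isWeight_tSpinor_one q ε),
    ← jordanGen_Kinv, mul_assoc, ((isLocalSeries_rSeries q hij).commute h).eq, mul_assoc]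

/-- Resummation with `P = t̃_- ⊗ K`, `Q = t̃_+ ⊗ J_-` and `γ = q^{1/4}`. -/
theorem t_zero_mul_rMatrix (q : DeformParam) {N : ℕ} {i j : Fin N} (hij : i ≠ j)
    (ε : SpinSign) :
    leg i (tSpinor q ε 0) * rMatrix q i j =
    rMatrix q i j * (leg i (tSpinor q ε 0) * leg j (jordanGen q .K) +
      (qpow q (1 / 4) * (1 - qpow q (-1))) •
        (leg i (tSpinor q ε 1) * leg j (jordanGen q .Jm))) := by
  rw [rMatrix_eq, ← mul_assoc, leg_left_mul_qJzJz q hij (isWeight_tSpinor_zero q ε), neg_neg,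
    ← jordanGen_K, mul_assoc (qJzJz q i j),
    mul_assoc (qJzJz q i j)]
  refine congrArg (qJzJz q i j * ·) (rSeries_mul_eq q hij ?_ ?_)
  · have h1 : jordanGen q .K * (jordanGen q .Kinv * jordanGen q .Jm) =
        qpow q (-(1 / 2)) • (jordanGen q .Kinv * jordanGen q .Jm * jordanGen q .K) := by
      rw [jordanGen_K, (isWeight_KinvJm q).qpowJz_mul, mul_neg_one]
    rw [rNilp, leg_mul_leg_mul hij, leg_mul_leg_mul hij, (tSpinor_relations q ε).2.2.2, h1,
      leg_add, add_mul, leg_mul_leg_smul, leg_mul_leg_smul, KinvJm_mul_K, leg_smul]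
    simp only [mul_smul_comm, smul_smul, ← qpow_add]
    norm_num
  · rw [rNilp, leg_mul_leg_mul hij, leg_mul_leg_mul hij, (tSpinor_relations q ε).2.2.1,
      Jm_mul_KinvJm, leg_mul_leg_smul, ← qpow_add]
    norm_num

/-! ### The braiding in matrix form -/

theorem tau_mul_rMatrix (q : DeformParam) {N : ℕ} {i j : Fin N} (hij : i ≠ j)
    (ε : SpinSign) :
    ∀ A : Fin 2, leg j (tauSpinor q ε A) * rMatrix q i j =
    rMatrix q i j * ∑ B, leg i (fluxOp q A B) * leg j (tauSpinor q ε B) := by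
  rw [fluxOp_eq, fluxCoeff_eq]
  refine Fin.forall_fin_two.2 ⟨?_, ?_⟩ <;>
    simp only [Fin.sum_univ_two, Matrix.of_apply, Matrix.cons_val', Matrix.cons_val_zero,
      Matrix.cons_val_one, Matrix.cons_val_fin_one, leg_zero, leg_smul, zero_mul, add_zero,
      smul_mul_assoc]
  · exact tau_zero_mul_rMatrix q hij ε
  · rw [add_comm]; exact tau_one_mul_rMatrix q hij ε

theorem rMatrix_mul_tau (q : DeformParam) {N : ℕ} {i j : Fin N} (hij : i ≠ j)
    (ε : SpinSign) :
    ∀ A : Fin 2, rMatrix q i j * leg i (tauSpinor q ε A) =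
    (∑ B, leg j (matDagger (antipodeFluxOp q) A B) * leg i (tauSpinor q ε B)) *
      rMatrix q i j := by
  rw [matDagger_antipodeFluxOp, antipodeFluxCoeff_eq]
  simp only [(leg_commute hij.symm _ _).eq]
  refine Fin.forall_fin_two.2 ⟨?_, ?_⟩ <;>
    simp only [Fin.sum_univ_two, Matrix.of_apply, Matrix.cons_val', Matrix.cons_val_zero,
      Matrix.cons_val_one, Matrix.cons_val_fin_one, leg_zero, leg_smul, mul_zero, zero_add,
      mul_smul_comm]
  · exact rMatrix_mul_tau_zero q hij ε
  · exact rMatrix_mul_tau_one q hij ε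

theorem rMatrix_mul_t (q : DeformParam) {N : ℕ} {i j : Fin N} (hij : i ≠ j)
    (ε : SpinSign) :
    ∀ A : Fin 2, rMatrix q i j * leg j (tSpinor q ε A) =
    (∑ B, leg i (antipodeFluxOp q A B) * leg j (tSpinor q ε B)) * rMatrix q i j := by
  rw [antipodeFluxOp_eq, antipodeFluxCoeff_eq]
  refine Fin.forall_fin_two.2 ⟨?_, ?_⟩ <;>
    simp only [Fin.sum_univ_two, Matrix.of_apply, Matrix.cons_val', Matrix.cons_val_zero,
      Matrix.cons_val_one, Matrix.cons_val_fin_one, leg_zero, leg_smul, zero_mul, add_zero,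
      smul_mul_assoc]
  · exact rMatrix_mul_t_zero q hij ε
  · rw [add_comm]; exact rMatrix_mul_t_one q hij ε

theorem t_mul_rMatrix (q : DeformParam) {N : ℕ} {i j : Fin N} (hij : i ≠ j)
    (ε : SpinSign) :
    ∀ A : Fin 2, leg i (tSpinor q ε A) * rMatrix q i j =
    rMatrix q i j * ∑ B, leg j (matDagger (fluxOp q) A B) * leg i (tSpinor q ε B) := by
  rw [matDagger_fluxOp, fluxCoeff_eq]
  simp only [(leg_commute hij.symm _ _).eq]
  refine Fin.forall_fin_two.2 ⟨?_, ?_⟩ <;>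
    simp only [Fin.sum_univ_two, Matrix.of_apply, Matrix.cons_val', Matrix.cons_val_zero,
      Matrix.cons_val_one, Matrix.cons_val_fin_one, leg_zero, leg_smul, mul_zero, zero_add,
      mul_smul_comm]
  · exact t_zero_mul_rMatrix q hij ε
  · exact t_one_mul_rMatrix q hij ε

/-! ### Products over the ribbons before a given one -/

section Transport

variable {R : Type*} [Semiring R]

/-- Conjugating a spinor successively by operators that act on it by holonomies. -/
theorem reverse_prod_mul_mul_prod (d : ℕ) (f g : Fin d → R) (M : Fin d → Matrix (Fin 2) (Fin 2) R)
    (s : Fin 2 → R) (hs : ∀ k A, f k * s A * g k = ∑ B, M k A B * s B)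
    (hc : ∀ k l A B, l < k → Commute (f k) (M l A B)) (A : Fin 2) :
    (List.ofFn f).reverse.prod * s A * (List.ofFn g).prod =
      ((List.ofFn M).prod.mulVec s) A := by
  induction d with
  | zero => simp
  | succ d ih =>
    -- The last conjugation is the outermost one and must pass all the holonomies produced before
    -- it.
    have hcom : ∀ B, Commute (f (Fin.last d))
        ((List.ofFn fun k : Fin d => M k.castSucc).prod A B) := by
      suffices h : ∀ (e : ℕ) (M' : Fin e → Matrix (Fin 2) (Fin 2) R),
          (∀ k A B, Commute (f (Fin.last d)) (M' k A B)) →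
          ∀ A B, Commute (f (Fin.last d)) ((List.ofFn M').prod A B) from
        h d _ (fun k A B => hc _ _ A B (Fin.castSucc_lt_last k)) A
      intro e M' hM'
      induction e with
      | zero =>
        intro A B
        simp only [List.ofFn_zero, List.prod_nil, Matrix.one_apply]
        split_ifs
        exacts [Commute.one_right _, Commute.zero_right _]
      | succ e ih' =>
        intro A B
        rw [List.ofFn_succ, List.prod_cons, Matrix.mul_apply]
        exact Commute.sum_right _ _ _ fun C _ =>
          (hM' _ _ _).mul_right (ih' _ (fun k => hM' _) C B)
    have ih' := ih (fun k => f k.castSucc) (fun k => g k.castSucc) (fun k => M k.castSucc)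
      (fun k => hs _) (fun k l A B h => hc _ _ A B (Fin.castSucc_lt_castSucc_iff.2 h))
    rw [List.ofFn_succ' f, List.ofFn_succ' g, List.ofFn_succ' M, List.concat_eq_append,
      List.concat_eq_append, List.concat_eq_append, List.reverse_append, List.prod_append,
      List.prod_append, List.prod_append]
    simp only [List.reverse_singleton, List.prod_singleton]
    -- The inner conjugations give `M_0 ⋯ M_{d-1} s`; the outer one then acts on `s` alone and
    -- inserts `M_d` directly before it.
    rw [← mul_assoc, mul_assoc (f _), mul_assoc (f _), ih', ← Matrix.mulVec_mulVec]
    simp only [Matrix.mulVec, dotProduct]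
    rw [Finset.mul_sum, Finset.sum_mul]
    refine Finset.sum_congr rfl fun B _ => ?_
    rw [← mul_assoc, (hcom B).eq, mul_assoc, mul_assoc, ← mul_assoc (f _), hs]

/-- The components of a product of holonomies applied to a spinor. -/
theorem prod_mulVec_eq_sum (d : ℕ) (M : Fin d → Matrix (Fin 2) (Fin 2) R) (s : Fin 2 → R)
    (A : Fin 2) :
    ((List.ofFn M).prod.mulVec s) A =
      ∑ p : Fin (d + 1) → Fin 2 with p 0 = A,
        (List.ofFn fun k : Fin d => M k (p k.castSucc) (p k.succ)).prod * s (p (Fin.last d)) := by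
  induction d generalizing A with
  | zero =>
    rw [Finset.sum_filter, ← (Equiv.funUnique (Fin 1) (Fin 2)).symm.sum_comp]
    simp
  | succ d ih =>
    rw [List.ofFn_succ, List.prod_cons, ← Matrix.mulVec_mulVec]
    simp only [Matrix.mulVec, dotProduct]
    have hR : (∑ p : Fin (d + 1 + 1) → Fin 2 with p 0 = A,
        (List.ofFn fun k => M k (p k.castSucc) (p k.succ)).prod * s (p (Fin.last (d + 1)))) =
        ∑ p : Fin (d + 1) → Fin 2, M 0 A (p 0) *
          ((List.ofFn fun k : Fin d => M k.succ (p k.castSucc) (p k.succ)).prod *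
            s (p (Fin.last d))) := by
      -- An index path of length `d + 2` is a first index, forced to be `A`, followed by a path of
      -- length `d + 1`.
      rw [Finset.sum_filter, ← (Fin.consEquiv fun _ : Fin (d + 2) => Fin 2).sum_comp,
        Fintype.sum_prod_type, Fintype.sum_eq_single A]
      · refine Finset.sum_congr rfl fun p _ => ?_
        simp [Fin.consEquiv, List.ofFn_succ, mul_assoc, ← Fin.succ_last]
      · intro B hB
        refine Finset.sum_eq_zero fun p _ => ?_
        simp [Fin.consEquiv, hB]
    have ih' := fun B => ih (fun k => M k.succ) B
    simp only [Matrix.mulVec, dotProduct] at ih'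
    simp only [hR, ih', Finset.sum_filter, Finset.mul_sum]
    rw [Finset.sum_comm]
    refine Finset.sum_congr rfl fun p _ => ?_
    rw [Fintype.sum_eq_single (p 0)]
    · simp
    · intro B hB
      simp [hB.symm]

end Transport

/-- Operators on distinct ribbons multiply factor by factor; this turns the matrix product into the
tensor product of the component formula. -/
theorem prod_leg_eq_map {N : ℕ} (F : Fin N → FockOp) (d : ℕ) (hd : d ≤ N) :
    (List.ofFn fun k : Fin d => leg (⟨k.1, k.2.trans_le hd⟩ : Fin N)
        (F ⟨k.1, k.2.trans_le hd⟩)).prod =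
      PiTensorProduct.map fun k : Fin N => if k.1 < d then F k else LinearMap.id := by
  induction d with
  | zero =>
    simp [Module.End.one_eq_id]
  | succ d ih =>
    rw [List.ofFn_succ', List.concat_eq_append, List.prod_append, List.prod_singleton]
    simp only [Fin.val_castSucc, Fin.val_last]
    rw [ih (by omega), leg, ← PiTensorProduct.map_mul]
    congr 1
    ext l : 1
    rcases lt_trichotomy l.1 d with h | h | h
    · have h' : l ≠ ⟨d, hd⟩ := fun h' => by simp [h'] at h
      simp [h, h', Module.End.mul_eq_comp, Nat.lt_succ_of_lt h]
    · obtain rfl : l = ⟨d, hd⟩ := Fin.ext h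
      simp [Module.End.mul_eq_comp]
    · have h' : l ≠ ⟨d, hd⟩ := fun h' => by simp [h'] at h
      have h1 : ¬ l.1 < d := by omega
      have h2 : ¬ l.1 < d + 1 := by omega
      simp [h1, h2, h', Module.End.mul_eq_comp]

theorem parallelTransport_eq_transportComponents {N : ℕ} (M : Matrix (Fin 2) (Fin 2) FockOp)
    (s : Fin 2 → FockOp) (n : Fin N) (A : Fin 2) :
    parallelTransport M s n A = transportComponents M s n A := by
  rw [parallelTransport, prodBefore, prod_mulVec_eq_sum, transportComponents]
  refine Finset.sum_congr rfl fun p _ => ?_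
  -- The family already contains the spinor at slot `n`; the product over the ribbons before `n`
  -- does not reach it, and `leg n` supplies it.
  set F : Fin N → FockOp := fun k =>
    if h : k < n then M (p ⟨k.1, Nat.lt_succ_of_lt h⟩) (p ⟨k.1 + 1, Nat.succ_lt_succ h⟩)
    else if k = n then s (p (Fin.last n.1)) else LinearMap.id with hF
  have h1 := prod_leg_eq_map F n.1 n.2.le
  have h2 : (fun k : Fin n.1 => leg (⟨k.1, k.2.trans_le n.2.le⟩ : Fin N)
      (F ⟨k.1, k.2.trans_le n.2.le⟩)) = fun k : Fin n.1 =>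
      (M.map (leg (⟨k.1, k.2.trans n.2⟩ : Fin N))) (p k.castSucc) (p k.succ) := by
    funext k
    have hk : (⟨k.1, k.2.trans n.2⟩ : Fin N) < n := k.2
    simp only [hF, dif_pos hk, Matrix.map_apply]
    rfl
  rw [← h2, h1, leg, ← PiTensorProduct.map_mul]
  congr 1
  ext l : 1
  rcases lt_trichotomy l n with h | h | h
  · simp [h, h.ne, Module.End.mul_eq_comp]
  · subst h
    simp [hF, Module.End.mul_eq_comp]
  · have h1 : ¬ l < n := h.not_gt
    simp [hF, h1, h.ne', Module.End.mul_eq_comp]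

/-- The braiding of a spinor past the preceding ribbons from the braiding of two ribbons. -/
theorem prodBeforeRev_mul_mul_prodBefore {N : ℕ} (n : Fin N)
    (f g : Fin N → Module.End ℂ (Vertex N))
    (M : Matrix (Fin 2) (Fin 2) FockOp) (s : Fin 2 → FockOp)
    (hs : ∀ k, k ≠ n → ∀ A, f k * leg n (s A) * g k = ∑ B, leg k (M A B) * leg n (s B))
    (hc : ∀ k l A B, k ≠ n → l ≠ n → l ≠ k → Commute (f k) (leg l (M A B))) (A : Fin 2) :
    prodBeforeRev n f * leg n (s A) * prodBefore n g = parallelTransport M s n A := by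
  refine reverse_prod_mul_mul_prod n.1 _ _ _ (fun B => leg n (s B)) (fun k A => ?_)
    (fun k l A B h => ?_) A
  · exact hs _ (Fin.ne_of_lt k.2) A
  · exact hc _ _ A B (Fin.ne_of_lt k.2) (Fin.ne_of_lt l.2) (Fin.ne_of_lt h)

theorem commute_ringInverse_left {R : Type*} [MonoidWithZero R] {a b : R} (ha : IsUnit a)
    (h : Commute a b) : Commute (Ring.inverse a) b := by
  obtain ⟨u, rfl⟩ := ha
  rw [Ring.inverse_unit]
  exact h.units_inv_left

/-! ### Entries of the fluxes -/

/-- Each entry is homogeneous, though of varying weight; this is what lets `rMatrix_commute_leg`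
apply to it. -/
theorem exists_isWeight_fluxOp (q : DeformParam) (A B : Fin 2) :
    ∃ w, IsWeight w (fluxOp q A B) := by
  rw [fluxOp_eq]
  fin_cases A <;> fin_cases B
  exacts [⟨_, isWeight_K q⟩, ⟨0, isWeight_zero 0⟩, ⟨_, (isWeight_Jp q).smul _⟩,
    ⟨_, isWeight_Kinv q⟩]

theorem exists_isWeight_antipodeFluxOp (q : DeformParam) (A B : Fin 2) :
    ∃ w, IsWeight w (antipodeFluxOp q A B) := by
  rw [antipodeFluxOp_eq]
  fin_cases A <;> fin_cases B
  exacts [⟨_, isWeight_Kinv q⟩, ⟨0, isWeight_zero 0⟩, ⟨_, (isWeight_Jp q).smul _⟩,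
    ⟨_, isWeight_K q⟩]

theorem exists_isWeight_matDagger_fluxOp (q : DeformParam) (A B : Fin 2) :
    ∃ w, IsWeight w (matDagger (fluxOp q) A B) := by
  rw [matDagger_fluxOp]
  fin_cases A <;> fin_cases B
  exacts [⟨_, isWeight_K q⟩, ⟨_, (isWeight_Jm q).smul _⟩, ⟨0, isWeight_zero 0⟩,
    ⟨_, isWeight_Kinv q⟩]

theorem exists_isWeight_matDagger_antipodeFluxOp (q : DeformParam) (A B : Fin 2) :
    ∃ w, IsWeight w (matDagger (antipodeFluxOp q) A B) := by
  rw [matDagger_antipodeFluxOp]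
  fin_cases A <;> fin_cases B
  exacts [⟨_, isWeight_Kinv q⟩, ⟨_, (isWeight_Jm q).smul _⟩, ⟨0, isWeight_zero 0⟩,
    ⟨_, isWeight_K q⟩]

end QRibbon

end

/-! ### The four braiding identities -/

theorem mainTheorem6 (q : QRibbon.DeformParam) (N : ℕ) :
    (∀ i j : Fin N, i ≠ j → IsUnit (QRibbon.rMatrix q i j)) ∧
    ∀ (n : Fin N) (ε : QRibbon.SpinSign) (A : Fin 2),
      (QRibbon.prodBeforeRev n (fun k => Ring.inverse (QRibbon.rMatrix q k n)) *
            QRibbon.leg n (QRibbon.tauSpinor q ε A) *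
            QRibbon.prodBefore n (fun k => QRibbon.rMatrix q k n) =
          QRibbon.parallelTransport (QRibbon.fluxOp q) (QRibbon.tauSpinor q ε) n A ∧
        QRibbon.parallelTransport (QRibbon.fluxOp q) (QRibbon.tauSpinor q ε) n A =
          QRibbon.transportComponents (QRibbon.fluxOp q) (QRibbon.tauSpinor q ε) n A) ∧
      (QRibbon.prodBeforeRev n (fun k => QRibbon.rMatrix q n k) *
            QRibbon.leg n (QRibbon.tauSpinor q ε A) *
            QRibbon.prodBefore n (fun k => Ring.inverse (QRibbon.rMatrix q n k)) =
          QRibbon.parallelTransport (QRibbon.matDagger (QRibbon.antipodeFluxOp q))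
            (QRibbon.tauSpinor q ε) n A ∧
        QRibbon.parallelTransport (QRibbon.matDagger (QRibbon.antipodeFluxOp q))
            (QRibbon.tauSpinor q ε) n A =
          QRibbon.transportComponents (QRibbon.matDagger (QRibbon.antipodeFluxOp q))
            (QRibbon.tauSpinor q ε) n A) ∧
      (QRibbon.prodBeforeRev n (fun k => QRibbon.rMatrix q k n) *
            QRibbon.leg n (QRibbon.tSpinor q ε A) *
            QRibbon.prodBefore n (fun k => Ring.inverse (QRibbon.rMatrix q k n)) =
          QRibbon.parallelTransport (QRibbon.antipodeFluxOp q) (QRibbon.tSpinor q ε) n A ∧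
        QRibbon.parallelTransport (QRibbon.antipodeFluxOp q) (QRibbon.tSpinor q ε) n A =
          QRibbon.transportComponents (QRibbon.antipodeFluxOp q) (QRibbon.tSpinor q ε) n A) ∧
      (QRibbon.prodBeforeRev n (fun k => Ring.inverse (QRibbon.rMatrix q n k)) *
            QRibbon.leg n (QRibbon.tSpinor q ε A) *
            QRibbon.prodBefore n (fun k => QRibbon.rMatrix q n k) =
          QRibbon.parallelTransport (QRibbon.matDagger (QRibbon.fluxOp q))
            (QRibbon.tSpinor q ε) n A ∧
        QRibbon.parallelTransport (QRibbon.matDagger (QRibbon.fluxOp q))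
            (QRibbon.tSpinor q ε) n A =
          QRibbon.transportComponents (QRibbon.matDagger (QRibbon.fluxOp q))
            (QRibbon.tSpinor q ε) n A) := by
  refine ⟨fun i j => QRibbon.isUnit_rMatrix q, fun n ε A => ⟨⟨?_, ?_⟩, ⟨?_, ?_⟩, ⟨?_, ?_⟩, ?_, ?_⟩⟩
  · refine QRibbon.prodBeforeRev_mul_mul_prodBefore n _ _ _ _ (fun k hk A => ?_)
      (fun k l A B hk hl hlk => ?_) A
    -- `Ring.inverse` is a true inverse here because `R` is a unit. In the first and fourth
    -- identities it cancels on the left, in the other two on the right.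
    · rw [mul_assoc, QRibbon.tau_mul_rMatrix q hk, ← mul_assoc,
        Ring.inverse_mul_cancel _ (QRibbon.isUnit_rMatrix q hk), one_mul]
    -- `R_{kn}` touches only the ribbons `k` and `n`, so it and its inverse commute with a flux
    -- entry on a third ribbon `l`.
    · obtain ⟨w, hw⟩ := QRibbon.exists_isWeight_fluxOp q A B
      exact QRibbon.commute_ringInverse_left (QRibbon.isUnit_rMatrix q hk)
        (QRibbon.rMatrix_commute_leg q hk hlk.symm hl.symm hw)
  · exact QRibbon.parallelTransport_eq_transportComponents _ _ n A
  · refine QRibbon.prodBeforeRev_mul_mul_prodBefore n _ _ _ _ (fun k hk A => ?_)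
      (fun k l A B hk hl hlk => ?_) A
    · rw [QRibbon.rMatrix_mul_tau q hk.symm, mul_assoc,
        Ring.mul_inverse_cancel _ (QRibbon.isUnit_rMatrix q hk.symm), mul_one]
    · obtain ⟨w, hw⟩ := QRibbon.exists_isWeight_matDagger_antipodeFluxOp q A B
      exact QRibbon.rMatrix_commute_leg q hk.symm hl.symm hlk.symm hw
  · exact QRibbon.parallelTransport_eq_transportComponents _ _ n A
  · refine QRibbon.prodBeforeRev_mul_mul_prodBefore n _ _ _ _ (fun k hk A => ?_)
      (fun k l A B hk hl hlk => ?_) A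
    · rw [QRibbon.rMatrix_mul_t q hk, mul_assoc,
        Ring.mul_inverse_cancel _ (QRibbon.isUnit_rMatrix q hk), mul_one]
    · obtain ⟨w, hw⟩ := QRibbon.exists_isWeight_antipodeFluxOp q A B
      exact QRibbon.rMatrix_commute_leg q hk hlk.symm hl.symm hw
  · exact QRibbon.parallelTransport_eq_transportComponents _ _ n A
  · refine QRibbon.prodBeforeRev_mul_mul_prodBefore n _ _ _ _ (fun k hk A => ?_)
      (fun k l A B hk hl hlk => ?_) A
    · rw [mul_assoc, QRibbon.t_mul_rMatrix q hk.symm, ← mul_assoc,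
        Ring.inverse_mul_cancel _ (QRibbon.isUnit_rMatrix q hk.symm), one_mul]
    · obtain ⟨w, hw⟩ := QRibbon.exists_isWeight_matDagger_fluxOp q A B
      exact QRibbon.commute_ringInverse_left (QRibbon.isUnit_rMatrix q hk.symm)
        (QRibbon.rMatrix_commute_leg q hk.symm hl.symm hlk.symm hw)
  · exact QRibbon.parallelTransport_eq_transportComponents _ _ n A
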